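/- Let $\mathbb{T}=\mathbb{R}/2\pi\mathbb{Z}$ and let $\phi(\xi,q)=\xi(\xi^2+q^2)$ for $(\xi,q)\in\mathbb{R}\times\mathbb{Z}$. Write $\langle a\rangle=(1+|a|^2)^{1/2}$, with $|\cdot|$ the Euclidean norm on $\mathbb{R}$ or $\mathbb{R}^2$, and let $$\hat u(\tau,\xi,q)=(2\pi)^{-3/2}\int_{\mathbb{R}}\int_{\mathbb{R}}\int_{\mathbb{T}}u(t,x,y)\,e^{-i(t\tau+x\xi+qy)}\,\mathrm{d}y\,\mathrm{d}x\,\mathrm{d}t$$ denote the space-time Fourier transform, extended to $L^2(\mathbb{R}\times\mathbb{R}\times\mathbb{T};\mathbb{C})$ by continuity. For $s,b\ge 0$ let $X_{s,b}(\phi)$ be the Bourgain space of all $u\in L^2(\mathbb{R}\times\mathbb{R}\times\mathbb{T};\mathbb{C})$ for which $$\|u\|_{X_{s,b}(\phi)}=\Big(\int_{\mathbb{R}}\int_{\mathbb{R}}\sum_{q\in\mathbb{Z}}\langle(\xi,q)\rangle^{2s}\,\langle\tau-\phi(\xi,q)\rangle^{2b}\,|\hat u(\tau,\xi,q)|^2\,\mathrm{d}\tau\,\mathrm{d}\xi\Big)^{1/2}$$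 is finite. **Theorem.** For every $\epsilon>0$ and every $b>\frac12$ there is a constant $C=C(\epsilon,b)\ge 0$ such that every $u\in X_{\epsilon,b}(\phi)$ satisfies $$\|u\|_{L^4_{txy}(\mathbb{R}\times\mathbb{R}\times\mathbb{T})}\le C\,\|u\|_{X_{\epsilon,b}(\phi)}.$$ -/

import Mathlib

open MeasureTheory FourierTransform
open scoped ENNReal Real

noncomputable section

instance ZK.fact_two_pi_pos : Fact ((0 : ℝ) < 2 * π) := ⟨Real.two_pi_pos⟩

/-- The torus `𝕋 = ℝ / 2πℤ`; its `volume` is the Lebesgue measure of total mass `2π`, and its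
characters are `y ↦ e^{iqy}` with `q ∈ ℤ`. -/
abbrev ZK.Torus : Type := AddCircle (2 * π)

/-- Points `(t, x, y)` of `ℝ × ℝ × 𝕋`, with the product measure as `volume`. -/
abbrev ZK.SpaceTime : Type := ℝ × ℝ × ZK.Torus

/-- The Euclidean plane of the variables `(t, x)`. -/
abbrev ZK.Plane : Type := WithLp 2 (ℝ × ℝ)

/-- The phase function `φ(ξ, q) = ξ (ξ² + q²)` of the Zakharov-Kuznetsov equation. -/
def ZK.phase (ξ : ℝ) (q : ℤ) : ℝ := ξ * (ξ ^ 2 + (q : ℝ) ^ 2)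

/-- The Japanese bracket `⟨(a, b)⟩ = (1 + a² + b²)^{1/2}`. -/
def ZK.bracket₂ (a b : ℝ) : ℝ := √(1 + (a ^ 2 + b ^ 2))

/-- The Japanese bracket `⟨a⟩ = (1 + a²)^{1/2}`. -/
def ZK.bracket (a : ℝ) : ℝ := √(1 + a ^ 2)

/-- The partial Fourier transform in `y`: `(t, x) ↦ ∫_𝕋 u(t, x, y) e^{-iqy} dy`. -/
def ZK.yCoeff (u : ZK.SpaceTime → ℂ) (q : ℤ) (z : ZK.Plane) : ℂ :=
  ∫ y : ZK.Torus, fourier (-q) y * u (z.fst, z.snd, y)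

/-- If `u` is square integrable on `ℝ × ℝ × 𝕋`, its partial Fourier transform in `y` is square
integrable on the plane. -/
theorem ZK.memLp_yCoeff {u : ZK.SpaceTime → ℂ} (hu : MemLp u 2 volume) (q : ℤ) :
    MemLp (ZK.yCoeff u q) 2 volume := by
  -- move to `(ℝ × ℝ) × 𝕋`
  have hassoc : MeasurePreserving
      (MeasurableEquiv.prodAssoc : (ℝ × ℝ) × ZK.Torus ≃ᵐ ℝ × ℝ × ZK.Torus) volume volume :=
    measurePreserving_prodAssoc volume volume volume
  have hv : MemLp (fun p : (ℝ × ℝ) × ZK.Torus => u (p.1.1, p.1.2, p.2)) 2 volume :=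
    hu.comp_measurePreserving hassoc
  set v : (ℝ × ℝ) × ZK.Torus → ℂ := fun p => u (p.1.1, p.1.2, p.2) with hvdef
  have hw : AEStronglyMeasurable (fun p : (ℝ × ℝ) × ZK.Torus => fourier (-q) p.2 * v p)
      (volume.prod volume) :=
    (((map_continuous (fourier (-q))).comp continuous_snd).aestronglyMeasurable).mul hv.1
  suffices h : MemLp (fun w : ℝ × ℝ => ∫ y : ZK.Torus, fourier (-q) y * v (w, y)) 2 volume from
    h.comp_measurePreserving (WithLp.volume_preserving_ofLp ℝ ℝ)
  refine ⟨hw.integral_prod_right', ?_⟩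
  rw [eLpNorm_lt_top_iff_lintegral_rpow_enorm_lt_top (by norm_num) (by norm_num)]
  have hfin : ∫⁻ p, ‖v p‖ₑ ^ (2 : ℝ) ∂(volume : Measure ((ℝ × ℝ) × ZK.Torus)) < ∞ := by
    have := (eLpNorm_lt_top_iff_lintegral_rpow_enorm_lt_top (by norm_num) (by norm_num)).1 hv.2
    simpa using this
  have hmeas : AEMeasurable (fun p => ‖v p‖ₑ ^ (2 : ℝ))
      ((volume : Measure (ℝ × ℝ)).prod (volume : Measure ZK.Torus)) :=
    hv.1.enorm.pow_const _
  have hslice : ∀ᵐ w : ℝ × ℝ, AEStronglyMeasurable (fun y : ZK.Torus => v (w, y)) volume :=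
    hv.1.prodMk_left
  calc ∫⁻ w : ℝ × ℝ, ‖∫ y : ZK.Torus, fourier (-q) y * v (w, y)‖ₑ ^ (2 : ℝ≥0∞).toReal
      ≤ ∫⁻ w : ℝ × ℝ, ENNReal.ofReal (2 * π) * ∫⁻ y : ZK.Torus, ‖v (w, y)‖ₑ ^ (2 : ℝ) := by
        refine lintegral_mono_ae ?_
        filter_upwards [hslice] with w hwm
        have h1 : ‖∫ y : ZK.Torus, fourier (-q) y * v (w, y)‖ₑ
            ≤ ∫⁻ y : ZK.Torus, ‖v (w, y)‖ₑ := by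
          refine (enorm_integral_le_lintegral_enorm _).trans (le_of_eq ?_)
          refine lintegral_congr fun y => ?_
          have : ‖fourier (-q) y‖ = 1 := by simp [fourier_apply, Circle.norm_coe]
          rw [enorm_mul, ← ofReal_norm, this, ENNReal.ofReal_one, one_mul]
        have h2 := ENNReal.lintegral_mul_le_Lp_mul_Lq (volume : Measure ZK.Torus)
          Real.HolderConjugate.two_two (f := fun _ => 1) (g := fun y => ‖v (w, y)‖ₑ)
          aemeasurable_const hwm.enorm
        simp only [Pi.mul_apply, one_mul, ENNReal.one_rpow, lintegral_const] at h2
        rw [AddCircle.measure_univ] at h2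
        have h3 := ENNReal.rpow_le_rpow (h1.trans h2) (by norm_num : (0 : ℝ) ≤ 2)
        rw [ENNReal.mul_rpow_of_nonneg _ _ (by norm_num : (0 : ℝ) ≤ 2), ← ENNReal.rpow_mul,
          ← ENNReal.rpow_mul] at h3
        simpa using h3
    _ = ENNReal.ofReal (2 * π) * ∫⁻ w : ℝ × ℝ, ∫⁻ y : ZK.Torus, ‖v (w, y)‖ₑ ^ (2 : ℝ) :=
        lintegral_const_mul' _ _ ENNReal.ofReal_ne_top
    _ = ENNReal.ofReal (2 * π) * ∫⁻ p, ‖v p‖ₑ ^ (2 : ℝ) := by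
        rw [← lintegral_prod _ hmeas]; rfl
    _ < ∞ := ENNReal.mul_lt_top ENNReal.ofReal_lt_top hfin

/-- The space-time Fourier transform of `u ∈ L²(ℝ × ℝ × 𝕋)`, with angular frequencies `τ`, `ξ` and
the unitary normalization: the `L²`-extension of
`û(τ, ξ, q) = (2π)^{-3/2} ∫_ℝ ∫_ℝ ∫_𝕋 u(t, x, y) e^{-i(tτ + xξ + qy)} dy dx dt`.
Mathlib's `𝓕` on `L²` of the plane has the kernel `e^{-2πi⟨z, w⟩}`, hence the division by `2π`. -/
def ZK.fourierTransform (u : Lp ℂ 2 (volume : Measure ZK.SpaceTime)) (τ ξ : ℝ) (q : ℤ) : ℂ :=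
  ((2 * π) ^ (-(3 / 2) : ℝ) : ℝ) *
    (𝓕 ((ZK.memLp_yCoeff (Lp.memLp u) q).toLp (ZK.yCoeff u q)) :
      Lp ℂ 2 (volume : Measure ZK.Plane)) (WithLp.toLp 2 (τ / (2 * π), ξ / (2 * π)))

/-- The norm of the Bourgain space `X_{s,b}(φ)`, as an extended nonnegative number:
`(∫∫ ∑_q ⟨(ξ, q)⟩^{2s} ⟨τ - φ(ξ, q)⟩^{2b} |û(τ, ξ, q)|² d(τ, ξ))^{1/2}`. -/
def ZK.bourgainNorm (s b : ℝ) (u : Lp ℂ 2 (volume : Measure ZK.SpaceTime)) : ℝ≥0∞ :=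
  (∫⁻ p : ℝ × ℝ, ∑' q : ℤ,
    ENNReal.ofReal (ZK.bracket₂ p.2 q ^ (2 * s) * ZK.bracket (p.1 - ZK.phase p.2 q) ^ (2 * b)) *
      ‖ZK.fourierTransform u p.1 p.2 q‖ₑ ^ 2) ^ (1 / 2 : ℝ)

/-- The Bourgain space `X_{s,b}(φ)` for `s, b ≥ 0`. In this range both weights are at least `1`, so
finiteness of the norm forces `û`, and hence `u`, to be square integrable: the space consists of the
`u ∈ L²(ℝ × ℝ × 𝕋)` of finite norm. -/
def ZK.BourgainSpace (s b : ℝ) : Set (Lp ℂ 2 (volume : Measure ZK.SpaceTime)) :=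
  {u | ZK.bourgainNorm s b u < ∞}

end

/-! Squaring turns the `L⁴` norm of `u` into the `L²` norm of `u²`, and by Plancherel into that of
the convolution `û * û`. Cauchy-Schwarz with the Bourgain weights (`lintegral_conv_sq_le`) then
leaves one thing to bound uniformly in `(τ, ξ, q)`: the sum over `q₁` and integral over `ξ₁` of
`⟨q₁⟩^{-2ε} ⟨q - q₁⟩^{-2ε} ⟨τ - φ(ξ₁, q₁) - φ(ξ - ξ₁, q - q₁)⟩^{-2b}`.

In the variables `s = 2ξ₁ - ξ`, `m = 2q₁ - q` the resonance function is `(ξ³ + ξq² + 3ξs² + 2qsm +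
ξm²) / 4`, a quadratic form of determinant proportional to `3ξ² - q²`. Symmetries of `φ` reduce
matters to `ξ₁, ξ - ξ₁ ≥ 0` and `q₁, q - q₁ ≥ 0`. Three regimes arise. (a) `ξ ≤ 2`: summing over
`q₁` costs `1/ξ`, which the length `ξ` of the range of `ξ₁` repays. (b) `ξ > 2` and `D = (3ξ² -
q²)/(12ξ)` not small: integrating in `ξ₁` gains `⟨T - Dm²⟩^{-1/2}`, comparable to the inverse
distance of `|m|` to a fixed point. The sum over `m` would diverge logarithmically, and `⟨m⟩^{-2ε}`
repairs this. (c) `ξ > 2` and `D` small: the form degenerates and `(ξ, q)` is near the line `q = √3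
ξ`, where the curvature of the graph of `φ` vanishes. If both frequencies lie on the same side of
this line, both are near it, so `s ≈ m/√3`. The phase then has slope at least of order `|m|` in
`ξ₁`, which again gains `⟨m⟩^{-1}`.

Hence frequencies are split into eight cones, by signs and by side of the lines `|q| = √3 |ξ|`. The
bound is proved for each cone and for bounded frequencies, summed by the triangle inequality, and
passed to the limit by Fatou. -/

noncomputable section

/-! ### Sums, integrals and convolutions of bracket weights -/

/-- The weight `⟨s⟩^{-2p}`, as an extended nonnegative number. -/
def ZK.decay (p s : ℝ) : ℝ≥0∞ := ENNReal.ofReal ((1 + s ^ 2) ^ (-p))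

namespace ZK

@[fun_prop]
theorem measurable_decay (p : ℝ) : Measurable (decay p) := by
  unfold decay; fun_prop

theorem decay_neg (p s : ℝ) : decay p (-s) = decay p s := by simp [decay]

theorem decay_ne_top (p s : ℝ) : decay p s ≠ ∞ := ENNReal.ofReal_ne_top

theorem decay_le_one {p : ℝ} (hp : 0 ≤ p) (s : ℝ) : decay p s ≤ 1 := by
  unfold decay
  rw [ENNReal.ofReal_le_one]
  exact Real.rpow_le_one_of_one_le_of_nonpos (by nlinarith [sq_nonneg s]) (by linarith)

theorem decay_le_mul {p c s t : ℝ} (hp : 0 ≤ p) (hc : 0 < c) (h : 1 + t ^ 2 ≤ c * (1 + s ^ 2)) :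
    decay p s ≤ ENNReal.ofReal (c ^ p) * decay p t := by
  unfold decay
  rw [← ENNReal.ofReal_mul (by positivity)]
  apply ENNReal.ofReal_le_ofReal
  calc (1 + s ^ 2) ^ (-p) ≤ ((1 + t ^ 2) / c) ^ (-p) := by
        apply Real.rpow_le_rpow_of_nonpos (by positivity) _ (by linarith)
        rw [div_le_iff₀ hc]; linarith
    _ = c ^ p * (1 + t ^ 2) ^ (-p) := by
        rw [Real.div_rpow (by positivity) hc.le, Real.rpow_neg hc.le, div_inv_eq_mul, mul_comm]

theorem decay_anti {p s t : ℝ} (hp : 0 ≤ p) (h : |t| ≤ |s|) : decay p s ≤ decay p t := by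
  have := decay_le_mul (p := p) (c := 1) (s := s) (t := t) hp one_pos
    (by nlinarith [sq_le_sq.2 h])
  simpa using this

theorem decay_mul_decay (p q s : ℝ) : decay p s * decay q s = decay (p + q) s := by
  unfold decay
  rw [← ENNReal.ofReal_mul (by positivity), ← Real.rpow_add (by positivity)]
  congr 2; ring

theorem decay_mul_decay_le {p q : ℝ} (hp : 0 ≤ p) (hq : 0 ≤ q) (s t : ℝ) :
    decay p s * decay q t ≤ decay (p + q) s + decay (p + q) t := by
  rcases le_total |s| |t| with h | h
  · calc decay p s * decay q t ≤ decay p s * decay q s := by gcongr; exact decay_anti hq h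
      _ = decay (p + q) s := decay_mul_decay ..
      _ ≤ _ := le_self_add
  · calc decay p s * decay q t ≤ decay p t * decay q t := by gcongr; exact decay_anti hp h
      _ = decay (p + q) t := decay_mul_decay ..
      _ ≤ _ := le_add_self

theorem decay_abs_sub_le (p c z κ : ℝ) :
    decay p (c * (|z| - κ)) ≤ decay p (c * (z - κ)) + decay p (c * (z + κ)) := by
  rcases abs_cases z with ⟨h, _⟩ | ⟨h, _⟩ <;> rw [h]
  · exact le_self_add
  · rw [show c * (-z - κ) = -(c * (z + κ)) by ring, decay_neg]
    exact le_add_self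

theorem lintegral_decay_lt_top {p : ℝ} (hp : 1 / 2 < p) : ∫⁻ s, decay p s < ∞ := by
  have h : Integrable (fun x : ℝ => (1 + ‖x‖ ^ 2) ^ (-(2 * p) / 2)) :=
    integrable_rpow_neg_one_add_norm_sq (by simp; linarith)
  convert h.lintegral_lt_top using 3 with s
  simp only [decay, Real.norm_eq_abs, sq_abs]
  congr 2; ring

theorem lintegral_comp_mul_add (f : ℝ → ℝ≥0∞) (hf : Measurable f) {c : ℝ} (hc : c ≠ 0) (d : ℝ) :
    ∫⁻ x, f (c * x + d) = ENNReal.ofReal |c⁻¹| * ∫⁻ x, f x := by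
  have h1 : ∫⁻ x, f (c * x + d) = ∫⁻ y, f (y + d) ∂(Measure.map (fun x => c * x) volume) := by
    rw [lintegral_map (by fun_prop) (by fun_prop)]
  rw [h1, Real.map_volume_mul_left hc, lintegral_smul_measure, lintegral_add_right_eq_self,
    smul_eq_mul]

/-- The weight varies by a bounded factor over a unit interval, so the sum is compared with the
integral. Uniformity in `θ` is what later allows arbitrary centres `κ`. -/
theorem tsum_decay_le {p : ℝ} (hp : 1 / 2 < p) (θ : ℝ) :
    ∑' n : ℤ, decay p (n + θ) ≤ ENNReal.ofReal (4 ^ p) * ∫⁻ s, decay p s := by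
  have hdisj : Pairwise (Function.onFun Disjoint fun n : ℤ => Set.Ioc (n : ℝ) (n + 1)) := by
    exact Set.pairwise_disjoint_Ioc_intCast ℝ
  calc ∑' n : ℤ, decay p (n + θ)
      ≤ ∑' n : ℤ, ENNReal.ofReal (4 ^ p) * ∫⁻ s in Set.Ioc (n : ℝ) (n + 1), decay p (s + θ) := by
        refine ENNReal.tsum_le_tsum fun n => ?_
        rw [← lintegral_const_mul _ (by fun_prop)]
        have : decay p (n + θ) = ∫⁻ s in Set.Ioc (n : ℝ) (n + 1), decay p (n + θ) := by
          simp
        rw [this]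
        refine setLIntegral_mono (by fun_prop) fun s hs => ?_
        refine decay_le_mul (by linarith) (by norm_num) ?_
        obtain ⟨h1, h2⟩ := hs
        nlinarith [sq_nonneg ((n + θ) - (s - n)), mul_nonneg (sub_nonneg.2 h1.le) (sub_nonneg.2 h2)]
    _ = ENNReal.ofReal (4 ^ p) * ∫⁻ s, decay p (s + θ) := by
        rw [ENNReal.tsum_mul_left, ← lintegral_iUnion (fun n => measurableSet_Ioc) hdisj,
          iUnion_Ioc_intCast, Measure.restrict_univ]
    _ = _ := by rw [lintegral_add_right_eq_self]

/-- One of `|x - s|`, `|t - x|` is at least `|t - s| / 2`; the corresponding factor is pulled out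
and the other one integrated. -/
theorem lintegral_decay_conv_le {p : ℝ} (hp : 0 ≤ p) (s t : ℝ) :
    ∫⁻ x, decay p (x - s) * decay p (t - x) ≤
      ENNReal.ofReal (4 ^ p) * (2 * ∫⁻ x, decay p x) * decay p (t - s) := by
  calc ∫⁻ x, decay p (x - s) * decay p (t - x)
      ≤ ∫⁻ x, ENNReal.ofReal (4 ^ p) * decay p (t - s) * (decay p (x - s) + decay p (t - x)) := by
        refine lintegral_mono fun x => ?_
        rcases le_total |x - s| |t - x| with h | h
        · have : decay p (t - x) ≤ ENNReal.ofReal (4 ^ p) * decay p (t - s) := by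
            refine decay_le_mul hp (by norm_num) ?_
            nlinarith [sq_le_sq.2 h, sq_nonneg ((x - s) - (t - x))]
          calc _ ≤ decay p (x - s) * (ENNReal.ofReal (4 ^ p) * decay p (t - s)) := by gcongr
            _ = ENNReal.ofReal (4 ^ p) * decay p (t - s) * decay p (x - s) := by ring
            _ ≤ _ := by gcongr; exact le_self_add
        · have : decay p (x - s) ≤ ENNReal.ofReal (4 ^ p) * decay p (t - s) := by
            refine decay_le_mul hp (by norm_num) ?_
            nlinarith [sq_le_sq.2 h, sq_nonneg ((x - s) - (t - x))]
          calc _ ≤ (ENNReal.ofReal (4 ^ p) * decay p (t - s)) * decay p (t - x) := by gcongr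
            _ ≤ _ := by gcongr; exact le_add_self
    _ = _ := by
        rw [lintegral_const_mul _ (by fun_prop), lintegral_add_left (by fun_prop),
          lintegral_sub_right_eq_self (decay p), lintegral_sub_left_eq_self (decay p)]
        ring

/-! ### Weights concentrated near parabolas -/

/-- Quadratic level sets: `|T - A s²|` controls the distance of `|s|` to some `κ ≥ 0`. -/
theorem exists_abs_sub_mul_le_of_pos {A : ℝ} (hA : 0 < A) (T : ℝ) :
    ∃ κ : ℝ, 0 ≤ κ ∧ (∀ s : ℝ, A * (|(|s| - κ)| * (|s| + κ)) ≤ |T - A * s ^ 2|) ∧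
      ∀ s : ℝ, √(A * |T|) * |(|s| - κ)| ≤ |T - A * s ^ 2| := by
  -- For `T ≥ 0` the point `κ` is the root `√(T/A)` and `A s² - T` factors. For `T ≤ 0` nothing
  -- cancels in `T - A s²`, and `κ = 0` serves.
  rcases le_total 0 T with h | h
  · have hk := Real.sqrt_nonneg (T / A)
    have hT : T = A * √(T / A) ^ 2 := by rw [Real.sq_sqrt (by positivity)]; field_simp
    have key : ∀ s : ℝ, A * (|(|s| - √(T / A))| * (|s| + √(T / A))) = |T - A * s ^ 2| := by
      intro s
      have hs : T - A * s ^ 2 = -(A * ((|s| - √(T / A)) * (|s| + √(T / A)))) := by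
        linear_combination hT + A * sq_abs s
      rw [hs, abs_neg, abs_mul, abs_mul, abs_of_pos hA,
        abs_of_nonneg (add_nonneg (abs_nonneg s) hk)]
    refine ⟨√(T / A), hk, fun s => (key s).le, fun s => ?_⟩
    have hAT : √(A * |T|) = A * √(T / A) := by
      rw [abs_of_nonneg h, show A * T = A ^ 2 * (T / A) by field_simp,
        Real.sqrt_mul (by positivity), Real.sqrt_sq hA.le]
    rw [← key s, hAT, mul_assoc, mul_comm (√(T / A))]
    gcongr
    linarith [abs_nonneg s]
  · have hT : ∀ s : ℝ, |T - A * s ^ 2| = |T| + A * s ^ 2 := by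
      intro s
      rw [abs_of_nonpos h, abs_of_nonpos (by nlinarith [mul_nonneg hA.le (sq_nonneg s)])]
      ring
    refine ⟨0, le_rfl, fun s => ?_, fun s => ?_⟩
    · rw [hT, sub_zero, add_zero, abs_abs, ← sq, sq_abs]
      linarith [abs_nonneg T]
    · rw [hT, sub_zero, abs_abs, ← Real.sqrt_sq_eq_abs s, ← Real.sqrt_mul (by positivity)]
      apply Real.sqrt_le_iff.2 ⟨by positivity, ?_⟩
      nlinarith [sq_nonneg (|T| - A * s ^ 2), mul_nonneg (abs_nonneg T) (mul_nonneg hA.le (sq_nonneg s))]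

/-- The version of `exists_abs_sub_mul_le_of_pos` for a coefficient of either sign. -/
theorem exists_abs_mul_sq_le {A : ℝ} (hA : A ≠ 0) (T : ℝ) :
    ∃ κ : ℝ, ∀ s : ℝ, |A| * (|s| - κ) ^ 2 ≤ |T - A * s ^ 2| := by
  have main : ∀ {A : ℝ}, 0 < A → ∀ T : ℝ, ∃ κ : ℝ, ∀ s : ℝ,
      A * (|s| - κ) ^ 2 ≤ |T - A * s ^ 2| := by
    intro A hA T
    obtain ⟨κ, hκ, h, -⟩ := exists_abs_sub_mul_le_of_pos hA T
    refine ⟨κ, fun s => le_trans ?_ (h s)⟩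
    rw [← sq_abs, sq]
    gcongr
    rw [abs_le]
    constructor <;> linarith [abs_nonneg s]
  rcases lt_or_gt_of_ne hA with h | h
  · obtain ⟨κ, hk⟩ := main (neg_pos.2 h) (-T)
    refine ⟨κ, fun s => ?_⟩
    rw [abs_of_neg h, ← abs_neg (T - _)]
    convert hk s using 2
    ring
  · rw [abs_of_pos h]; exact main h T

/-- Summation over a shifted lattice of a weight concentrated near a parabola. -/
theorem tsum_decay_quadratic_le {p A : ℝ} (hp : 1 / 2 < p) (hp1 : p ≤ 1) (hA : 0 < A) (hA2 : A ≤ 2)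
    (T h : ℝ) :
    ∑' n : ℤ, decay p (T - A * (n + h) ^ 2) ≤
      ENNReal.ofReal (3 / A) * (2 * (ENNReal.ofReal (4 ^ p) * ∫⁻ s, decay p s)) := by
  obtain ⟨κ, hκ⟩ := exists_abs_mul_sq_le hA.ne' T
  rw [abs_of_pos hA] at hκ
  calc ∑' n : ℤ, decay p (T - A * (n + h) ^ 2)
      ≤ ∑' n : ℤ, ENNReal.ofReal (3 / A) * (decay p (n + (h - κ)) + decay p (n + (h + κ))) := by
        refine ENNReal.tsum_le_tsum fun n => ?_
        calc decay p (T - A * (n + h) ^ 2)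
            ≤ ENNReal.ofReal ((3 / A) ^ p) * decay p (1 * (|(n + h : ℝ)| - κ)) := by
              refine decay_le_mul (by linarith) (by positivity) ?_
              rw [div_mul_eq_mul_div, le_div_iff₀ hA]
              have h1 := hκ (n + h)
              have h2 := sq_abs (T - A * (n + h) ^ 2)
              nlinarith [sq_nonneg (|T - A * (n + h) ^ 2| - 1)]
          _ ≤ _ := by
              gcongr
              -- Since `3/A ≥ 1` and `p ≤ 1`, only the first power of `1/A` is lost; it will cancel
              -- exactly against an interval of length `A`.
              · apply Real.rpow_le_self_of_one_le _ hp1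
                rw [le_div_iff₀ hA]; linarith
              · refine (decay_abs_sub_le ..).trans (le_of_eq ?_)
                congr 2 <;> ring
    _ = ENNReal.ofReal (3 / A) *
        (∑' n : ℤ, decay p (n + (h - κ)) + ∑' n : ℤ, decay p (n + (h + κ))) := by
        rw [ENNReal.tsum_mul_left, ENNReal.tsum_add]
    _ ≤ _ := by
        gcongr
        rw [two_mul]
        exact add_le_add (tsum_decay_le hp _) (tsum_decay_le hp _)

/-- Integration of a weight concentrated near a parabola that is steep on the range considered. -/
theorem lintegral_le_of_steep {p κ μ α : ℝ} (hp : 1 / 2 < p) (F : ℝ → ℝ≥0∞)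
    (hF : ∀ x, F x ≠ 0 → ∃ r, F x ≤ decay p r ∧
      μ * |(|2 * x + α| - κ)| ≤ |r| ∧ (|2 * x + α| - κ) ^ 2 ≤ |r|) (hμ : 0 ≤ μ) :
    ∫⁻ x, F x ≤ ENNReal.ofReal (3 ^ p) * (∫⁻ s, decay p s) * decay (1 / 2) μ := by
  -- With `d = |2x + α| - κ` the two lower bounds combine to `c² d² = d² + μ² d² ≤ |r| + r²`, so the
  -- weight lives at scale `1/c = ⟨μ⟩⁻¹`. The bound `d² ≤ |r|` keeps this meaningful for small `μ`.
  set c := √(1 + μ ^ 2) with hc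
  have hc0 : 0 < c := by positivity
  have hc2 : c ^ 2 = 1 + μ ^ 2 := Real.sq_sqrt (by positivity)
  have hdec : ENNReal.ofReal (c⁻¹) = decay (1 / 2) μ := by
    rw [decay, Real.rpow_neg (by positivity), hc, Real.sqrt_eq_rpow]
  have hint : ∀ d : ℝ, ∫⁻ x, decay p (2 * c * x + d) =
      ENNReal.ofReal (1 / 2) * decay (1 / 2) μ * ∫⁻ s, decay p s := by
    intro d
    rw [lintegral_comp_mul_add _ (by fun_prop) (by positivity), abs_of_pos (by positivity), ← hdec,
      ← ENNReal.ofReal_mul (by norm_num)]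
    congr 2
    field_simp
  calc ∫⁻ x, F x ≤ ∫⁻ x, ENNReal.ofReal (3 ^ p) *
        (decay p (2 * c * x + c * (α - κ)) + decay p (2 * c * x + c * (α + κ))) := by
        refine lintegral_mono fun x => ?_
        by_cases h0 : F x = 0
        · simp [h0]
        obtain ⟨r, h1, h2, h3⟩ := hF x h0
        refine h1.trans ?_
        calc decay p r ≤ ENNReal.ofReal (3 ^ p) * decay p (c * (|2 * x + α| - κ)) := by
              refine decay_le_mul (by linarith) (by norm_num) ?_
              have h4 : (μ * |(|2 * x + α| - κ)|) ^ 2 ≤ |r| ^ 2 := by gcongr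
              rw [sq_abs] at h4
              rw [mul_pow, hc2]
              rw [mul_pow, sq_abs] at h4
              nlinarith [sq_abs r, sq_nonneg (|r| - 1)]
          _ ≤ _ := by
              gcongr
              refine (decay_abs_sub_le ..).trans (le_of_eq ?_)
              congr 2 <;> ring
    _ = ENNReal.ofReal (3 ^ p) * (∫⁻ s, decay p s) * decay (1 / 2) μ := by
        rw [lintegral_const_mul _ (by fun_prop), lintegral_add_left (by fun_prop), hint, hint]
        rw [← two_mul, ← mul_assoc 2, ← mul_assoc 2]
        have : (2 : ℝ≥0∞) * ENNReal.ofReal (1 / 2) = 1 := by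
          rw [← ENNReal.ofReal_ofNat, ← ENNReal.ofReal_mul (by norm_num)]; norm_num
        rw [this]; ring

/-- Applied to `q₁` and `q - q₁`, this trades the two brackets for one in their difference `2q₁ -
q`, the variable in which the phase is quadratic. -/
theorem decay_mul_decay_le_sub {p : ℝ} (hp : 0 ≤ p) (s t : ℝ) :
    decay p s * decay p t ≤ ENNReal.ofReal (2 ^ p) * decay p (s - t) := by
  have : decay p s * decay p t = decay p (√((1 + s ^ 2) * (1 + t ^ 2) - 1)) := by
    unfold decay
    rw [← ENNReal.ofReal_mul (by positivity), ← Real.mul_rpow (by positivity) (by positivity),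
      Real.sq_sqrt (by nlinarith [sq_nonneg (s * t), sq_nonneg s, sq_nonneg t])]
    congr 2; ring
  rw [this]
  apply decay_le_mul hp (by norm_num)
  rw [Real.sq_sqrt (by nlinarith [sq_nonneg (s * t), sq_nonneg s, sq_nonneg t])]
  nlinarith [sq_nonneg (s * t), sq_nonneg (s + t)]

theorem tsum_decay_two_mul_le {p : ℝ} (hp : 1 / 2 < p) (θ : ℝ) :
    ∑' n : ℤ, decay p (2 * n + θ) ≤ ENNReal.ofReal (4 ^ p) * ∫⁻ s, decay p s := by
  refine le_trans (ENNReal.tsum_le_tsum fun n => ?_) (tsum_decay_le hp (θ / 2))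
  apply decay_anti (by linarith)
  rw [show 2 * (n : ℝ) + θ = 2 * (n + θ / 2) by ring, abs_mul, abs_two]
  linarith [abs_nonneg (n + θ / 2)]

/-! ### The uniform bound for the pair kernel, in three regimes -/

/-- The weight `⟨q₁⟩^{-2ε} ⟨q₂⟩^{-2ε} ⟨τ - φ(ξ₁, q₁) - φ(ξ₂, q₂)⟩^{-2b}` at
`(ξ₁, q₁) + (ξ₂, q₂) = (ξ, q)`, restricted to pairs of frequencies in `S`. -/
def pairWeight (S : Set (ℝ × ℤ)) (ε b τ ξ : ℝ) (q : ℤ) (p : ℝ × ℤ) : ℝ≥0∞ :=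
  (S ∩ {p | (ξ - p.1, q - p.2) ∈ S}).indicator (fun p => decay ε p.2 * decay ε ((q - p.2 : ℤ) : ℝ) *
    decay b (τ - phase p.1 p.2 - phase (ξ - p.1) (q - p.2))) p

/-- The total mass of `pairWeight`. -/
def pairKernel (S : Set (ℝ × ℤ)) (ε b τ ξ : ℝ) (q : ℤ) : ℝ≥0∞ :=
  ∑' n : ℤ, ∫⁻ x : ℝ, pairWeight S ε b τ ξ q (x, n)

open Classical in
theorem pairWeight_apply (S : Set (ℝ × ℤ)) (ε b τ ξ x : ℝ) (q n : ℤ) :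
    pairWeight S ε b τ ξ q (x, n) = if (x, n) ∈ S ∧ (ξ - x, q - n) ∈ S then
      decay ε n * decay ε ((q - n : ℤ) : ℝ) * decay b (τ - phase x n - phase (ξ - x) (q - n))
    else 0 := by
  unfold pairWeight
  rw [Set.indicator_apply]
  rfl

theorem phase_add_phase (ξ x : ℝ) (q n : ℤ) :
    phase x n + phase (ξ - x) (q - n) = (1 / 4) * (ξ ^ 3 + 3 * ξ * (2 * x - ξ) ^ 2 + ξ * q ^ 2 +
      ξ * (2 * n - q) ^ 2 + 2 * q * (2 * x - ξ) * (2 * n - q)) := by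
  unfold phase; push_cast; ring

/-- Nonnegativity confines `ξ₁` to `[0, ξ]`. For fixed `ξ₁` the phase is a parabola in `q₁` with
leading coefficient `ξ`, so the sum costs at most a multiple of `1/ξ`; the factors in `ε` are not
needed. -/
theorem pairKernel_le_of_small {S : Set (ℝ × ℤ)} (hS : ∀ p ∈ S, 0 ≤ p.1) {ε b : ℝ} (hε : 0 < ε)
    (hb : 1 / 2 < b) (hb1 : b ≤ 1) (τ : ℝ) {ξ : ℝ} (q : ℤ) (hξ : ξ ≤ 2) :
    pairKernel S ε b τ ξ q ≤
      ENNReal.ofReal 3 * (2 * (ENNReal.ofReal (4 ^ b) * ∫⁻ s, decay b s)) := by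
  have hmeas : ∀ n : ℤ, Measurable fun x : ℝ =>
      decay b (τ - phase x n - phase (ξ - x) (q - n)) := by
    intro n; unfold phase; fun_prop
  calc pairKernel S ε b τ ξ q
      ≤ ∑' n : ℤ, ∫⁻ x in Set.Icc 0 ξ, decay b (τ - phase x n - phase (ξ - x) (q - n)) := by
        refine ENNReal.tsum_le_tsum fun n => ?_
        rw [← lintegral_indicator measurableSet_Icc]
        refine lintegral_mono fun x => ?_
        refine Set.indicator_apply_le' (fun h => ?_) fun _ => zero_le
        have hx : x ∈ Set.Icc 0 ξ := ⟨hS _ h.1, by simpa using hS _ h.2⟩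
        simp only [Set.indicator_of_mem hx]
        calc _ ≤ 1 * 1 * decay b (τ - phase x n - phase (ξ - x) (q - n)) := by
              gcongr <;> exact decay_le_one hε.le _
          _ = _ := by ring
    _ = ∫⁻ x in Set.Icc 0 ξ, ∑' n : ℤ, decay b (τ - phase x n - phase (ξ - x) (q - n)) :=
        (lintegral_tsum fun n => (hmeas n).aemeasurable).symm
    _ ≤ _ := by
        rcases le_or_gt ξ 0 with h0 | h0
        · rw [setLIntegral_measure_zero _ _ (by simp [h0])]
          exact zero_le
        · calc _ ≤ ∫⁻ x in Set.Icc 0 ξ, ENNReal.ofReal (3 / ξ) *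
                (2 * (ENNReal.ofReal (4 ^ b) * ∫⁻ s, decay b s)) := by
                refine lintegral_mono fun x => ?_
                -- Square completed in `n`: the `n`-dependent part of the phase sum is `ξ (n + h)²`
                -- with `h = (q (2x - ξ)/ξ - q)/2`.
                refine le_trans (le_of_eq ?_) (tsum_decay_quadratic_le hb hb1 h0 hξ
                  (τ - (1 / 4) * (ξ ^ 3 + 3 * ξ * (2 * x - ξ) ^ 2 + ξ * q ^ 2 -
                    q ^ 2 * (2 * x - ξ) ^ 2 / ξ)) ((q * (2 * x - ξ) / ξ - q) / 2))
                refine tsum_congr fun n => ?_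
                congr 1
                rw [sub_sub, phase_add_phase]
                field_simp
                ring
            _ = _ := by
                rw [setLIntegral_const, Real.volume_Icc, sub_zero, mul_right_comm,
                  ← ENNReal.ofReal_mul (by positivity), div_mul_cancel₀ _ h0.ne']

/-- The bound for a fixed `q₁`, given that the phase is steep as a function of `ξ₁`. -/
theorem lintegral_pairWeight_le {S : Set (ℝ × ℤ)} {ε b τ ξ κ μ : ℝ} {q n : ℤ} (hε : 0 < ε)
    (hb : 1 / 2 < b) (hμ : 0 ≤ μ)
    (hκ : ∀ x, (x, n) ∈ S → (ξ - x, q - n) ∈ S →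
      μ * |(|2 * x + (q * (2 * n - q) / (3 * ξ) - ξ)| - κ)| ≤
        |τ - phase x n - phase (ξ - x) (q - n)| ∧
      (|2 * x + (q * (2 * n - q) / (3 * ξ) - ξ)| - κ) ^ 2 ≤
        |τ - phase x n - phase (ξ - x) (q - n)|) :
    ∫⁻ x, pairWeight S ε b τ ξ q (x, n) ≤ ENNReal.ofReal (2 ^ ε) *
      (ENNReal.ofReal (3 ^ b) * (∫⁻ s, decay b s)) * (decay ε (2 * n - q) * decay (1 / 2) μ) := by
  set F : ℝ → ℝ≥0∞ := fun x => (S ∩ {p | (ξ - p.1, q - p.2) ∈ S}).indicator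
    (fun p => decay b (τ - phase p.1 p.2 - phase (ξ - p.1) (q - p.2))) (x, n) with hF
  calc ∫⁻ x, pairWeight S ε b τ ξ q (x, n)
      ≤ ∫⁻ x, ENNReal.ofReal (2 ^ ε) * decay ε (2 * n - q) * F x := by
        refine lintegral_mono fun x => ?_
        refine Set.indicator_apply_le' (fun h => ?_) fun _ => zero_le
        simp only [hF, Set.indicator_of_mem h]
        refine mul_le_mul' ?_ le_rfl
        refine (decay_mul_decay_le_sub hε.le _ _).trans (le_of_eq ?_)
        congr 2; push_cast; ring
    _ = ENNReal.ofReal (2 ^ ε) * decay ε (2 * n - q) * ∫⁻ x, F x :=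
        lintegral_const_mul' _ _ (ENNReal.mul_ne_top ENNReal.ofReal_ne_top (decay_ne_top _ _))
    _ ≤ ENNReal.ofReal (2 ^ ε) * decay ε (2 * n - q) *
        (ENNReal.ofReal (3 ^ b) * (∫⁻ s, decay b s) * decay (1 / 2) μ) := by
        refine mul_le_mul' le_rfl ?_
        refine lintegral_le_of_steep (κ := κ) (α := q * (2 * n - q) / (3 * ξ) - ξ) hb F (fun x hx => ?_) hμ
        have hmem := Set.mem_of_indicator_ne_zero hx
        exact ⟨_, (Set.indicator_of_mem hmem _).le, hκ x hmem.1 hmem.2⟩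
    _ = _ := by ring

theorem phase_complete_square {ξ : ℝ} (hξ : 2 < ξ) (τ x : ℝ) (q n : ℤ) :
    τ - phase x n - phase (ξ - x) (q - n) =
      (τ - (1 / 4) * (ξ ^ 3 + ξ * q ^ 2) - (3 * ξ ^ 2 - q ^ 2) / (12 * ξ) * (2 * n - q) ^ 2) -
      3 * ξ / 4 * (2 * x + (q * (2 * n - q) / (3 * ξ) - ξ)) ^ 2 := by
  have : ξ ≠ 0 := by positivity
  rw [sub_sub, phase_add_phase]
  field_simp
  ring

/-- Integrating in `ξ₁` across the level `T - D m²`, `m = 2q₁ - q`, gains `⟨μ⟩⁻¹` with `μ² = |T - D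
m²|`. As `|D| ≥ 1/4`, this is at least `(|m| - κ')²/4`. The resulting `⟨|m| - κ'⟩⁻¹ ⟨m⟩^{-2ε}` is
summable uniformly in `κ'`; no sign condition on `S` is required. -/
theorem pairKernel_le_of_nondegenerate (S : Set (ℝ × ℤ)) {ε b : ℝ} (hε : 0 < ε)
    (hb : 1 / 2 < b) (τ : ℝ) {ξ : ℝ} (q : ℤ) (hξ : 2 < ξ)
    (hD : 1 / 4 ≤ |(3 * ξ ^ 2 - q ^ 2) / (12 * ξ)|) :
    pairKernel S ε b τ ξ q ≤
      ENNReal.ofReal (2 ^ ε) * (ENNReal.ofReal (3 ^ b) * (∫⁻ s, decay b s)) *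
      (ENNReal.ofReal (4 ^ (1 / 2 : ℝ)) *
        (3 * (ENNReal.ofReal (4 ^ (ε + 1 / 2)) * ∫⁻ s, decay (ε + 1 / 2) s))) := by
  set D := (3 * ξ ^ 2 - q ^ 2) / (12 * ξ) with hDdef
  set T := τ - (1 / 4) * (ξ ^ 3 + ξ * q ^ 2) with hT
  have hD0 : D ≠ 0 := by
    rintro h; rw [h, abs_zero] at hD; linarith
  obtain ⟨κ', hκ'⟩ := exists_abs_mul_sq_le hD0 T
  have key : ∀ n : ℤ, ∫⁻ x, pairWeight S ε b τ ξ q (x, n) ≤ ENNReal.ofReal (2 ^ ε) *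
      (ENNReal.ofReal (3 ^ b) * (∫⁻ s, decay b s)) * (ENNReal.ofReal (4 ^ (1 / 2 : ℝ)) *
      (decay (ε + 1 / 2) (2 * n + (-q)) + (decay (ε + 1 / 2) (2 * n + (-q - κ')) +
        decay (ε + 1 / 2) (2 * n + (-q + κ'))))) := by
    intro n
    obtain ⟨κ, hκ0, h1, h2⟩ := exists_abs_sub_mul_le_of_pos (A := 3 * ξ / 4) (by positivity)
      (T - D * (2 * n - q) ^ 2)
    refine (lintegral_pairWeight_le (κ := κ) (μ := √|T - D * (2 * n - q) ^ 2|) hε hb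
      (Real.sqrt_nonneg _) fun x _ _ => ?_).trans ?_
    · rw [phase_complete_square hξ]
      constructor
      · refine le_trans ?_ (h2 _)
        gcongr
        nlinarith [abs_nonneg (T - D * (2 * n - q) ^ 2)]
      · refine le_trans ?_ (h1 _)
        set z := |2 * x + (q * (2 * n - q) / (3 * ξ) - ξ)| with hz
        have hz0 : 0 ≤ z := abs_nonneg _
        have h3 : |z - κ| ≤ z + κ := by rw [abs_le]; constructor <;> linarith
        have h4 : |z - κ| * |z - κ| ≤ |z - κ| * (z + κ) := by gcongr
        rw [← sq_abs, sq]
        nlinarith [mul_nonneg (abs_nonneg (z - κ)) (add_nonneg hz0 hκ0)]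
    · refine mul_le_mul' le_rfl ?_
      have h3 : decay (1 / 2) √|T - D * (2 * n - q) ^ 2| ≤
          ENNReal.ofReal (4 ^ (1 / 2 : ℝ)) * decay (1 / 2) (|(2 * n - q : ℝ)| - κ') := by
        refine decay_le_mul (by norm_num) (by norm_num) ?_
        rw [Real.sq_sqrt (abs_nonneg _)]
        nlinarith [hκ' (2 * n - q), sq_nonneg (|(2 * n - q : ℝ)| - κ')]
      calc _ ≤ decay ε (2 * n - q) *
            (ENNReal.ofReal (4 ^ (1 / 2 : ℝ)) * decay (1 / 2) (|(2 * n - q : ℝ)| - κ')) := mul_le_mul' le_rfl h3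
        _ = ENNReal.ofReal (4 ^ (1 / 2 : ℝ)) *
            (decay ε (2 * n - q) * decay (1 / 2) (|(2 * n - q : ℝ)| - κ')) := by ring
        _ ≤ _ := by
            refine mul_le_mul' le_rfl ?_
            refine (decay_mul_decay_le hε.le (by norm_num) _ _).trans ?_
            refine add_le_add ?_ ?_
            · apply le_of_eq; congr 1
            · have := decay_abs_sub_le (ε + 1 / 2) 1 (2 * n - q) κ'
              rw [one_mul, one_mul, one_mul] at this
              refine this.trans (le_of_eq ?_)
              congr 2 <;> ring
  refine (ENNReal.tsum_le_tsum key).trans ?_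
  rw [ENNReal.tsum_mul_left, ENNReal.tsum_mul_left, ENNReal.tsum_add, ENNReal.tsum_add]
  have h2 : (1 / 2 : ℝ) < ε + 1 / 2 := by linarith
  refine mul_le_mul' le_rfl (mul_le_mul' le_rfl ?_)
  calc _ ≤ _ := add_le_add (tsum_decay_two_mul_le h2 _)
        (add_le_add (tsum_decay_two_mul_le h2 _) (tsum_decay_two_mul_le h2 _))
    _ = _ := by ring

/-- Two frequencies on the same side of the line `√3 ξ = q` whose sum is close to this line. -/
theorem steep_of_degenerate {σ ξ q x n : ℝ} (hσ : |σ| = 1) (hξ : 2 < ξ) (hq : 0 ≤ q)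
    (hd1 : 0 ≤ σ * (√3 * x - n)) (hd2 : 0 ≤ σ * (√3 * (ξ - x) - (q - n)))
    (hD : |(3 * ξ ^ 2 - q ^ 2) / (12 * ξ)| < 1 / 4) :
    (|2 * n - q| - 2) / 4 ≤ |2 * x + (q * (2 * n - q) / (3 * ξ) - ξ)| := by
  have h3 : √3 ^ 2 = 3 := Real.sq_sqrt (by norm_num)
  have h3' : (3 / 2 : ℝ) < √3 := by rw [Real.lt_sqrt (by norm_num)]; norm_num
  have h3'' : √3 < 2 := by rw [Real.sqrt_lt' (by norm_num)]; norm_num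
  generalize √3 = r at *
  -- `D = (√3 ξ - q)(√3 ξ + q)/(12ξ)`, and the cofactor of `√3 ξ - q` is at least `√3/12`.
  have hD' : |r * ξ - q| < r := by
    have e : (3 * ξ ^ 2 - q ^ 2) / (12 * ξ) = (r * ξ - q) * ((r * ξ + q) / (12 * ξ)) := by
      field_simp; linear_combination -ξ ^ 2 * h3
    rw [e, abs_mul, abs_of_pos (a := (r * ξ + q) / (12 * ξ)) (by positivity)] at hD
    have e2 : r / 12 ≤ (r * ξ + q) / (12 * ξ) := by
      rw [div_le_div_iff₀ (by norm_num) (by positivity)]; linarith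
    have := mul_le_mul_of_nonneg_left e2 (abs_nonneg (r * ξ - q))
    nlinarith [abs_nonneg (r * ξ - q)]
  -- The signed quantities in `hd1` and `hd2` are both nonnegative, so their difference is bounded
  -- by their sum, which is `|√3 ξ - q|`. This is where lying on the same side of the line enters.
  have hX : |r * (2 * x - ξ) - (2 * n - q)| < r := by
    rw [abs_lt] at hD' ⊢
    rcases (abs_eq (by norm_num : (0 : ℝ) ≤ 1)).1 hσ with rfl | rfl <;> constructor <;> linarith
  rw [abs_lt] at hX hD'
  have hq4 : 3 * ξ ≤ 4 * q := by nlinarith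
  set m : ℝ := 2 * n - q with hm
  clear_value m
  -- For `|m| > 2 > √3`, `hX` forces `2x - ξ` to have the sign of `m`. It therefore reinforces `q
  -- m/(3ξ)`, whose size is at least `|m|/4` by `hq4`.
  rcases le_or_gt (|m|) 2 with hm2 | hm2
  · exact le_trans (by linarith) (abs_nonneg _)
  rcases lt_abs.1 hm2 with h | h
  · rw [abs_of_pos (by linarith : 0 < m)]
    refine le_trans ?_ (le_abs_self _)
    have h5 : m / 4 ≤ q * m / (3 * ξ) := by
      rw [div_le_div_iff₀ (by norm_num) (by positivity)]
      linarith [mul_le_mul_of_nonneg_left hq4 (by linarith : 0 ≤ m)]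
    have h6 : 0 < 2 * x - ξ := pos_of_mul_pos_right (by linarith : 0 < r * (2 * x - ξ)) (by linarith)
    linarith
  · rw [abs_of_neg (by linarith : m < 0)]
    refine le_trans ?_ (neg_le_abs _)
    have h5 : -m / 4 ≤ -(q * m / (3 * ξ)) := by
      rw [← neg_div, div_le_div_iff₀ (by norm_num) (by positivity)]
      linarith [mul_le_mul_of_nonneg_left hq4 (by linarith : 0 ≤ -m)]
    have h6 : 0 < ξ - 2 * x := pos_of_mul_pos_right (by linarith : 0 < r * (ξ - 2 * x)) (by linarith)
    linarith

/-- Here `D m²` gives no usable growth, but by `steep_of_degenerate` the square completed in `ξ₁` is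
evaluated at distance at least `(|m| - 2)/4` from its vertex. The slope there supplies the factor
`⟨m⟩⁻¹`. -/
theorem pairKernel_le_of_degenerate {S : Set (ℝ × ℤ)} {σ : ℝ} (hσ : |σ| = 1)
    (hS : ∀ p ∈ S, 0 ≤ p.1 ∧ 0 ≤ p.2 ∧ 0 ≤ σ * (√3 * p.1 - p.2)) {ε b : ℝ} (hε : 0 < ε)
    (hb : 1 / 2 < b) (τ : ℝ) {ξ : ℝ} (q : ℤ) (hξ : 2 < ξ)
    (hD : |(3 * ξ ^ 2 - q ^ 2) / (12 * ξ)| < 1 / 4) :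
    pairKernel S ε b τ ξ q ≤
      ENNReal.ofReal (2 ^ ε) * (ENNReal.ofReal (3 ^ b) * (∫⁻ s, decay b s)) *
      (ENNReal.ofReal (32 ^ (1 / 2 : ℝ)) *
        (ENNReal.ofReal (4 ^ (ε + 1 / 2)) * ∫⁻ s, decay (ε + 1 / 2) s)) := by
  set D := (3 * ξ ^ 2 - q ^ 2) / (12 * ξ) with hDdef
  set T := τ - (1 / 4) * (ξ ^ 3 + ξ * q ^ 2) with hT
  have steep : ∀ (x : ℝ) (n : ℤ), (x, n) ∈ S → (ξ - x, q - n) ∈ S →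
      (|(2 * n - q : ℝ)| - 2) / 4 ≤ |2 * x + (q * (2 * n - q) / (3 * ξ) - ξ)| := by
    intro x n hx hx'
    obtain ⟨-, hn0, hd1⟩ := hS _ hx
    obtain ⟨-, hn0', hd2⟩ := hS _ hx'
    dsimp only at hn0 hd1 hn0' hd2
    push_cast at hd2
    exact steep_of_degenerate hσ hξ (by exact_mod_cast (by omega : 0 ≤ q)) hd1 hd2 hD
  have key : ∀ n : ℤ, ∫⁻ x, pairWeight S ε b τ ξ q (x, n) ≤ ENNReal.ofReal (2 ^ ε) *
      (ENNReal.ofReal (3 ^ b) * (∫⁻ s, decay b s)) * (ENNReal.ofReal (32 ^ (1 / 2 : ℝ)) *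
      decay (ε + 1 / 2) (2 * n + (-q))) := by
    intro n
    obtain ⟨κ, hκ0, h1, h2⟩ := exists_abs_sub_mul_le_of_pos (A := 3 * ξ / 4) (by positivity)
      (T - D * (2 * n - q) ^ 2)
    refine (lintegral_pairWeight_le (κ := κ) (μ := max 0 ((|(2 * n - q : ℝ)| - 2) / 4)) hε hb
      (le_max_left _ _) fun x hx hx' => ?_).trans ?_
    · rw [phase_complete_square hξ]
      have hst := steep x n hx hx'
      have h1' := h1 (2 * x + (q * (2 * n - q) / (3 * ξ) - ξ))
      set z := |2 * x + (q * (2 * n - q) / (3 * ξ) - ξ)| with hz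
      have hz0 : 0 ≤ z := abs_nonneg _
      have hle : ∀ c, c ≤ z + κ → c * |z - κ| ≤ 3 * ξ / 4 * (|z - κ| * (z + κ)) := by
        intro c hc
        have h4 : |z - κ| * c ≤ |z - κ| * (z + κ) := by gcongr
        nlinarith [mul_nonneg (abs_nonneg (z - κ)) (add_nonneg hz0 hκ0)]
      constructor
      · exact (hle _ (max_le (by linarith) (by linarith))).trans h1'
      · refine le_trans ?_ h1'
        rw [← sq_abs, sq]
        apply hle
        rw [abs_le]; constructor <;> linarith
    · refine mul_le_mul' le_rfl ?_
      set m : ℝ := 2 * n - q with hm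
      have h4 : decay (1 / 2) (max 0 ((|m| - 2) / 4)) ≤
          ENNReal.ofReal (32 ^ (1 / 2 : ℝ)) * decay (1 / 2) m := by
        refine decay_le_mul (by norm_num) (by norm_num) ?_
        have e1 := le_max_left 0 ((|m| - 2) / 4)
        have e2 := le_max_right 0 ((|m| - 2) / 4)
        set μ := max 0 ((|m| - 2) / 4)
        have e3 : |m| ≤ 4 * μ + 2 := by linarith
        have e4 : |m| ^ 2 ≤ (4 * μ + 2) ^ 2 := by gcongr
        rw [sq_abs] at e4
        nlinarith [sq_nonneg (4 * μ - 2)]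
      calc _ ≤ decay ε m * (ENNReal.ofReal (32 ^ (1 / 2 : ℝ)) * decay (1 / 2) m) := mul_le_mul' le_rfl h4
        _ = ENNReal.ofReal (32 ^ (1 / 2 : ℝ)) * (decay ε m * decay (1 / 2) m) := by ring
        _ = _ := by rw [decay_mul_decay, hm]; rfl
  refine (ENNReal.tsum_le_tsum key).trans ?_
  rw [ENNReal.tsum_mul_left, ENNReal.tsum_mul_left]
  refine mul_le_mul' le_rfl (mul_le_mul' le_rfl ?_)
  exact tsum_decay_two_mul_le (by linarith) _

theorem exists_pairKernel_le_of_nonneg {S : Set (ℝ × ℤ)} {σ : ℝ} (hσ : |σ| = 1)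
    (hS : ∀ p ∈ S, 0 ≤ p.1 ∧ 0 ≤ p.2 ∧ 0 ≤ σ * (√3 * p.1 - p.2)) {ε b : ℝ} (hε : 0 < ε)
    (hb : 1 / 2 < b) (hb1 : b ≤ 1) :
    ∃ C < ∞, ∀ τ ξ q, pairKernel S ε b τ ξ q ≤ C := by
  have hfin := (lintegral_decay_lt_top hb).ne
  have hfin' := (lintegral_decay_lt_top (p := ε + 1 / 2) (by linarith)).ne
  set I := ∫⁻ s, decay b s
  set J := ∫⁻ s, decay (ε + 1 / 2) s
  refine ⟨max (ENNReal.ofReal 3 * (2 * (ENNReal.ofReal (4 ^ b) * I)))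
    (max (ENNReal.ofReal (2 ^ ε) * (ENNReal.ofReal (3 ^ b) * I) * (ENNReal.ofReal (4 ^ (1 / 2 : ℝ)) *
        (3 * (ENNReal.ofReal (4 ^ (ε + 1 / 2)) * J))))
      (ENNReal.ofReal (2 ^ ε) * (ENNReal.ofReal (3 ^ b) * I) *
        (ENNReal.ofReal (32 ^ (1 / 2 : ℝ)) * (ENNReal.ofReal (4 ^ (ε + 1 / 2)) * J)))),
    ?_, fun τ ξ q => ?_⟩
  · finiteness
  · rcases le_or_gt ξ 2 with h | h
    · exact le_max_of_le_left (pairKernel_le_of_small (fun p hp => (hS p hp).1) hε hb hb1 τ q h)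
    · rcases le_or_gt (1 / 4) |(3 * ξ ^ 2 - q ^ 2) / (12 * ξ)| with hD | hD
      · exact le_max_of_le_right (le_max_of_le_left
          (pairKernel_le_of_nondegenerate S hε hb τ q h hD))
      · exact le_max_of_le_right (le_max_of_le_right
          (pairKernel_le_of_degenerate hσ hS hε hb τ q h hD))

/-! ### Symmetries of the phase and the eight cones -/

/-- The phase is odd in `ξ`, and the weight in the modulation is even. -/
theorem pairKernel_reflect_fst (S : Set (ℝ × ℤ)) (ε b τ ξ : ℝ) (q : ℤ) :
    pairKernel ((fun p => (-p.1, p.2)) ⁻¹' S) ε b τ ξ q = pairKernel S ε b (-τ) (-ξ) q := by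
  classical
  refine tsum_congr fun n => ?_
  rw [← lintegral_neg_eq_self]
  refine lintegral_congr fun x => ?_
  have h : decay b (τ - phase (-x) n - phase (ξ - -x) (q - n)) =
      decay b (-τ - phase x n - phase (-ξ - x) (q - n)) := by
    rw [← decay_neg]; congr 1; unfold phase; ring
  rw [pairWeight_apply, pairWeight_apply, h]
  refine if_congr ?_ rfl rfl
  simp only [Set.mem_preimage, neg_neg, show -(ξ - -x) = -ξ - x by ring]

/-- The phase and the weights are even in `q`. -/
theorem pairKernel_reflect_snd (S : Set (ℝ × ℤ)) (ε b τ ξ : ℝ) (q : ℤ) :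
    pairKernel ((fun p => (p.1, -p.2)) ⁻¹' S) ε b τ ξ q = pairKernel S ε b τ ξ (-q) := by
  classical
  unfold pairKernel
  rw [← (Equiv.neg ℤ).tsum_eq]
  refine tsum_congr fun n => lintegral_congr fun x => ?_
  have h : decay b (τ - phase x (-n) - phase (ξ - x) (q - -n)) =
      decay b (τ - phase x n - phase (ξ - x) (-q - n)) := by
    congr 1; unfold phase; push_cast; ring
  have h1 : decay ε ((-n : ℤ) : ℝ) = decay ε n := by rw [Int.cast_neg, decay_neg]
  have h2 : decay ε ((q - -n : ℤ) : ℝ) = decay ε ((-q - n : ℤ) : ℝ) := by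
    rw [← decay_neg]; congr 1; push_cast; ring
  rw [Equiv.neg_apply, pairWeight_apply, pairWeight_apply, h, h1, h2]
  refine if_congr ?_ rfl rfl
  simp only [Set.mem_preimage, neg_neg, show -(q - -n) = -q - n by ring]

/-- Frequencies are sorted by the signs of `ξ` and `q` and by the sign of the Gaussian curvature of
the graph of the phase. -/
def coneIndex (p : ℝ × ℤ) : Bool × Bool × Bool :=
  (decide (0 ≤ p.1), decide (0 ≤ p.2), decide (|(p.2 : ℝ)| ≤ √3 * |p.1|))

theorem measurable_coneIndex : Measurable coneIndex := by
  have h : ∀ {P : ℝ × ℤ → Prop} [DecidablePred P], MeasurableSet {p | P p} →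
      Measurable fun p => decide (P p) := by
    intro P _ hP
    refine measurable_to_bool ?_
    simpa [Set.preimage] using hP
  unfold coneIndex
  refine (h ?_).prodMk ((h ?_).prodMk (h ?_))
  · exact measurableSet_le measurable_const measurable_fst
  · exact measurableSet_le measurable_const measurable_snd
  · exact measurableSet_le (by fun_prop) (by fun_prop)

/-- Reflections carry each cone into the closed quadrant `ξ, q ≥ 0`; the third index becomes the
sign `σ` telling the side of `q = √3 ξ`. -/
theorem exists_pairKernel_le (j : Bool × Bool × Bool) {ε b : ℝ} (hε : 0 < ε)
    (hb : 1 / 2 < b) (hb1 : b ≤ 1) :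
    ∃ C < ∞, ∀ τ ξ q, pairKernel (coneIndex ⁻¹' {j}) ε b τ ξ q ≤ C := by
  have reflect_fst : ∀ S : Set (ℝ × ℤ), (∃ C < ∞, ∀ τ ξ q, pairKernel S ε b τ ξ q ≤ C) →
      ∃ C < ∞, ∀ τ ξ q, pairKernel ((fun p => (-p.1, p.2)) ⁻¹' S) ε b τ ξ q ≤ C := by
    rintro S ⟨C, hC, h⟩
    exact ⟨C, hC, fun τ ξ q => by rw [pairKernel_reflect_fst]; exact h _ _ _⟩
  have reflect_snd : ∀ S : Set (ℝ × ℤ), (∃ C < ∞, ∀ τ ξ q, pairKernel S ε b τ ξ q ≤ C) →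
      ∃ C < ∞, ∀ τ ξ q, pairKernel ((fun p => (p.1, -p.2)) ⁻¹' S) ε b τ ξ q ≤ C := by
    rintro S ⟨C, hC, h⟩
    exact ⟨C, hC, fun τ ξ q => by rw [pairKernel_reflect_snd]; exact h _ _ _⟩
  have base : ∀ k : Bool, ∃ C < ∞, ∀ τ ξ q, pairKernel {p | 0 ≤ p.1 ∧ 0 ≤ p.2 ∧
      0 ≤ (bif k then 1 else -1) * (√3 * p.1 - p.2)} ε b τ ξ q ≤ C := fun k =>
    exists_pairKernel_le_of_nonneg (σ := bif k then 1 else -1) (by cases k <;> simp)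
      (fun p hp => hp) hε hb hb1
  have mono : ∀ S S' : Set (ℝ × ℤ), S ⊆ S' → (∃ C < ∞, ∀ τ ξ q, pairKernel S' ε b τ ξ q ≤ C) →
      ∃ C < ∞, ∀ τ ξ q, pairKernel S ε b τ ξ q ≤ C := by
    rintro S S' hSS ⟨C, hC, h⟩
    refine ⟨C, hC, fun τ ξ q => le_trans (ENNReal.tsum_le_tsum fun n => lintegral_mono fun x => ?_)
      (h τ ξ q)⟩
    unfold pairWeight
    apply Set.indicator_le_indicator_of_subset
    · exact fun p hp => ⟨hSS hp.1, hSS hp.2⟩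
    · exact fun _ => zero_le
  obtain ⟨i, j, k⟩ := j
  have hmem : ∀ p : ℝ × ℤ, coneIndex p = (i, j, k) →
      0 ≤ (bif k then (1 : ℝ) else -1) * (√3 * |p.1| - |(p.2 : ℝ)|) ∧
      (0 ≤ p.1 ↔ i = true) ∧ (0 ≤ p.2 ↔ j = true) := by
    intro p hp
    simp only [coneIndex, Prod.mk.injEq] at hp
    obtain ⟨rfl, rfl, rfl⟩ := hp
    refine ⟨?_, by simp, by simp⟩
    by_cases h : |(p.2 : ℝ)| ≤ √3 * |p.1|
    · simp [h]
    · simpa [h] using (not_le.1 h).le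
  have hsnd : ∀ p : ℝ × ℤ, p.2 < 0 → (p.2 : ℝ) < 0 := fun p hp => by exact_mod_cast hp
  have hsnd' : ∀ p : ℝ × ℤ, 0 ≤ p.2 → (0 : ℝ) ≤ p.2 := fun p hp => by exact_mod_cast hp
  cases i <;> cases j
  · refine mono _ _ ?_ (reflect_fst _ (reflect_snd _ (base k)))
    intro p hp
    obtain ⟨h1, h2, h3⟩ := hmem p hp
    simp only [Bool.false_eq_true, iff_false, not_le] at h2 h3
    rw [abs_of_neg h2, abs_of_neg (hsnd p h3)] at h1
    exact ⟨by simpa using h2.le, by simpa using h3.le, by simpa using h1⟩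
  · refine mono _ _ ?_ (reflect_fst _ (base k))
    intro p hp
    obtain ⟨h1, h2, h3⟩ := hmem p hp
    simp only [Bool.false_eq_true, iff_false, not_le, iff_true] at h2 h3
    rw [abs_of_neg h2, abs_of_nonneg (hsnd' p h3)] at h1
    exact ⟨by simpa using h2.le, by simpa using h3, by simpa using h1⟩
  · refine mono _ _ ?_ (reflect_snd _ (base k))
    intro p hp
    obtain ⟨h1, h2, h3⟩ := hmem p hp
    simp only [Bool.false_eq_true, iff_false, not_le, iff_true] at h2 h3
    rw [abs_of_nonneg h2, abs_of_neg (hsnd p h3)] at h1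
    exact ⟨by simpa using h2, by simpa using h3.le, by simpa using h1⟩
  · refine mono _ _ ?_ (base k)
    intro p hp
    obtain ⟨h1, h2, h3⟩ := hmem p hp
    simp only [iff_true] at h2 h3
    rw [abs_of_nonneg h2, abs_of_nonneg (hsnd' p h3)] at h1
    exact ⟨h2, h3, h1⟩

/-! ### Cauchy-Schwarz for weighted convolutions -/

theorem lintegral_enorm_sq {α : Type*} [MeasurableSpace α] {μ : Measure α} (g : α → ℂ) :
    ∫⁻ x, ‖g x‖ₑ ^ 2 ∂μ = eLpNorm g 2 μ ^ 2 := by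
  simpa using (eLpNorm_nnreal_pow_eq_lintegral (p := 2) (f := g) (μ := μ) (by norm_num)).symm

theorem lintegral_mul_sq_le {α : Type*} [MeasurableSpace α] (μ : Measure α) {f g : α → ℝ≥0∞}
    (hf : AEMeasurable f μ) (hg : AEMeasurable g μ) :
    (∫⁻ x, f x * g x ∂μ) ^ 2 ≤ (∫⁻ x, f x ^ 2 ∂μ) * ∫⁻ x, g x ^ 2 ∂μ := by
  have h := ENNReal.lintegral_mul_le_Lp_mul_Lq μ Real.HolderConjugate.two_two hf hg
  simp only [Pi.mul_apply, ENNReal.rpow_two] at h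
  calc _ ≤ _ := pow_le_pow_left' h 2
    _ = _ := by
      rw [mul_pow, ← ENNReal.rpow_natCast, ← ENNReal.rpow_natCast, ← ENNReal.rpow_mul,
        ← ENNReal.rpow_mul]
      norm_num

/-- The Schur-type bound for convolutions behind bilinear estimates: if the weights `v` satisfy
`v² * v² ≤ M`, then `‖(f v) * (f v)‖₂² ≤ M ‖f‖₂⁴`. -/
theorem lintegral_conv_sq_le {G : Type*} [MeasurableSpace G] [AddCommGroup G] [MeasurableAdd₂ G]
    [MeasurableNeg G] (μ : Measure G) [SFinite μ] [μ.IsAddLeftInvariant] {f v : G → ℝ≥0∞}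
    (hf : Measurable f) (hv : Measurable v) {M : ℝ≥0∞}
    (hM : ∀ w, ∫⁻ z, v z ^ 2 * v (w - z) ^ 2 ∂μ ≤ M) :
    ∫⁻ w, (∫⁻ z, (f z * v z) * (f (w - z) * v (w - z)) ∂μ) ^ 2 ∂μ ≤
      M * (∫⁻ z, f z ^ 2 ∂μ) ^ 2 := by
  have hsub : Measurable fun p : G × G => p.1 - p.2 := by
    simp only [sub_eq_add_neg]; fun_prop
  have hsub' : ∀ w : G, Measurable fun z : G => w - z := fun w =>
    hsub.comp (measurable_const.prodMk measurable_id)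
  calc ∫⁻ w, (∫⁻ z, (f z * v z) * (f (w - z) * v (w - z)) ∂μ) ^ 2 ∂μ
      ≤ ∫⁻ w, (∫⁻ z, f z ^ 2 * f (w - z) ^ 2 ∂μ) * M ∂μ := by
        refine lintegral_mono fun w => ?_
        have h1 : Measurable fun z => f z * f (w - z) := hf.mul (hf.comp (hsub' w))
        have h2 : Measurable fun z => v z * v (w - z) := hv.mul (hv.comp (hsub' w))
        calc _ = (∫⁻ z, (f z * f (w - z)) * (v z * v (w - z)) ∂μ) ^ 2 := by
              congr 2; funext z; ring
          _ ≤ _ := lintegral_mul_sq_le μ h1.aemeasurable h2.aemeasurable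
          _ ≤ _ := by simp only [mul_pow]; gcongr; exact hM w
    _ = (∫⁻ w, ∫⁻ z, f z ^ 2 * f (w - z) ^ 2 ∂μ ∂μ) * M := by
        refine lintegral_mul_const _ ?_
        exact Measurable.lintegral_prod_right'
          (f := fun p : G × G => f p.2 ^ 2 * f (p.1 - p.2) ^ 2)
          (((hf.comp measurable_snd).pow_const 2).mul ((hf.comp hsub).pow_const 2))
    _ = (∫⁻ z, ∫⁻ w, f z ^ 2 * f (w - z) ^ 2 ∂μ ∂μ) * M := by
        rw [lintegral_lintegral_swap]
        exact (((hf.comp measurable_snd).pow_const 2).mul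
          ((hf.comp hsub).pow_const 2)).aemeasurable
    _ = M * (∫⁻ z, f z ^ 2 ∂μ) ^ 2 := by
        have : ∀ z, ∫⁻ w, f z ^ 2 * f (w - z) ^ 2 ∂μ = f z ^ 2 * ∫⁻ w, f w ^ 2 ∂μ := by
          intro z
          have hm : Measurable fun w => f (w - z) :=
            hf.comp (hsub.comp (measurable_id.prodMk measurable_const))
          rw [lintegral_const_mul _ (hm.pow_const 2)]
          congr 1
          have := lintegral_add_right_eq_self (μ := μ) (fun w => f (w - z) ^ 2) z
          simpa using this.symm
        simp only [this]
        rw [lintegral_mul_const _ (hf.pow_const 2)]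
        ring

/-! ### Fourier integrals and the `L²` Fourier transform -/

section Plancherel

variable {E : Type*} [NormedAddCommGroup E] [InnerProductSpace ℝ E] [FiniteDimensional ℝ E]
  [MeasurableSpace E] [BorelSpace E]

theorem integral_fourierInv_smul {f g : E → ℂ} (hf : Integrable f) (hg : Integrable g) :
    ∫ x, 𝓕⁻ f x • g x = ∫ x, f x • 𝓕⁻ g x := by
  have h : ∫ x, 𝓕 f x • g (-x) = ∫ x, f x • 𝓕 (fun y => g (-y)) x := by
    simpa using! VectorFourier.integral_fourierIntegral_smul_eq_flip (L := innerₗ E)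
      Real.continuous_fourierChar continuous_inner hf hg.comp_neg
  have h2 : 𝓕 (fun y => g (-y)) = 𝓕⁻ g := (Real.fourierInv_eq_fourier_comp_neg g).symm
  rw [← h2, ← h, ← integral_neg_eq_self]
  simp [Real.fourierInv_eq_fourier_neg]

theorem continuous_fourierInv {f : E → ℂ} (hf : Integrable f) : Continuous (𝓕⁻ f) := by
  have h : 𝓕⁻ f = fun w => 𝓕 f (-w) := funext (Real.fourierInv_eq_fourier_neg f)
  rw [h]
  exact (VectorFourier.fourierIntegral_continuous Real.continuous_fourierChar
    (L := innerₗ E) continuous_inner hf).comp continuous_neg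

/-- On `L¹ ∩ L²` the inverse Fourier transform of `L²` is given by the Fourier integral. -/
theorem coeFn_fourierInv_toLp {f : E → ℂ} (h1 : Integrable f) (h2 : MemLp f 2) :
    ((𝓕⁻ (h2.toLp f) : Lp ℂ 2 (volume : Measure E)) : E → ℂ) =ᵐ[volume] 𝓕⁻ f := by
  refine ae_eq_of_integral_contDiff_smul_eq
    ((Lp.memLp _).locallyIntegrable (by norm_num)) (continuous_fourierInv h1).locallyIntegrable
    fun g hg hgc => ?_
  have hg' : ContDiff ℝ ((⊤ : ℕ∞) : WithTop ℕ∞) (fun x => (g x : ℂ)) :=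
    Complex.ofRealCLM.contDiff.comp hg
  have hgc' : HasCompactSupport (fun x => (g x : ℂ)) :=
    HasCompactSupport.comp_left (g := fun t : ℝ => (t : ℂ)) hgc Complex.ofReal_zero
  let G : SchwartzMap E ℂ := hgc'.toSchwartzMap hg'
  have hG : ∀ x, G x = g x := fun x => rfl
  -- The `L²` transform agrees with the distributional one, so it can be moved onto the test
  -- function and back with the Fourier integral.
  have key : (𝓕⁻ (h2.toLp f : TemperedDistribution E ℂ)) G =
      ((𝓕⁻ (h2.toLp f) : Lp ℂ 2 (volume : Measure E)) : TemperedDistribution E ℂ) G := by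
    rw [Lp.fourierInv_toTemperedDistribution_eq (h2.toLp f)]
  rw [TemperedDistribution.fourierInv_apply, Lp.toTemperedDistribution_apply,
    Lp.toTemperedDistribution_apply] at key
  simp only [hG, Complex.coe_smul] at key
  rw [← key]
  calc ∫ x, (𝓕⁻ G) x • h2.toLp f x = ∫ x, 𝓕⁻ (G : E → ℂ) x • f x := by
        refine integral_congr_ae ?_
        filter_upwards [h2.coeFn_toLp] with x hx
        rw [hx, SchwartzMap.fourierInv_coe]
    _ = ∫ x, G x • 𝓕⁻ f x := integral_fourierInv_smul G.integrable h1
    _ = _ := by simp [hG]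

/-- Plancherel's inequality for integrable functions. -/
theorem lintegral_fourierInv_sq_le {f : E → ℂ} (h1 : Integrable f) :
    ∫⁻ x, ‖𝓕⁻ f x‖ₑ ^ 2 ≤ ∫⁻ x, ‖f x‖ₑ ^ 2 := by
  by_cases h : ∫⁻ x, ‖f x‖ₑ ^ 2 = ∞
  · rw [h]; exact le_top
  have h2 : MemLp f 2 := by
    refine ⟨h1.1, ?_⟩
    rw [eLpNorm_lt_top_iff_lintegral_rpow_enorm_lt_top (by norm_num) (by norm_num)]
    simpa using Ne.lt_top h
  have hn : eLpNorm (𝓕⁻ f) 2 volume = eLpNorm f 2 volume := by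
    rw [← eLpNorm_congr_ae (coeFn_fourierInv_toLp h1 h2), ← eLpNorm_congr_ae h2.coeFn_toLp,
      ← Lp.enorm_def, ← Lp.enorm_def, ← ofReal_norm, ← ofReal_norm]
    congr 1
    exact (Lp.fourierTransformₗᵢ E ℂ).symm.norm_map _
  rw [lintegral_enorm_sq, lintegral_enorm_sq, hn]

theorem fourierInv_mul_fourierInv {f g : E → ℂ} (hf : Integrable f) (hg : Integrable g) (x : E) :
    𝓕⁻ f x * 𝓕⁻ g x = 𝓕⁻ (convolution f g (ContinuousLinearMap.mul ℂ ℂ) volume) x := by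
  rw [Real.fourierInv_eq_fourier_neg, Real.fourierInv_eq_fourier_neg,
    Real.fourierInv_eq_fourier_neg, Real.fourier_mul_convolution_eq hf hg]

end Plancherel

/-! ### Slicing space-time and Parseval in `y` -/

theorem lintegral_plane (F : ℝ × ℝ → ℝ≥0∞) :
    ∫⁻ z : Plane, F (z.fst, z.snd) = ∫⁻ p, F p := by
  have h := (WithLp.volume_preserving_ofLp ℝ ℝ).lintegral_comp_emb
    (MeasurableEquiv.toLp 2 (ℝ × ℝ)).symm.measurableEmbedding F
  exact h

theorem lintegral_spaceTime {F : SpaceTime → ℝ≥0∞} (hF : AEMeasurable F) :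
    ∫⁻ p, F p = ∫⁻ z : Plane, ∫⁻ y : Torus, F (z.fst, z.snd, y) := by
  have hassoc : MeasurePreserving
      (MeasurableEquiv.prodAssoc : (ℝ × ℝ) × Torus ≃ᵐ ℝ × ℝ × Torus) volume volume :=
    measurePreserving_prodAssoc volume volume volume
  rw [lintegral_plane fun p => ∫⁻ y : Torus, F (p.1, p.2, y)]
  rw [← hassoc.lintegral_comp_emb MeasurableEquiv.prodAssoc.measurableEmbedding]
  exact lintegral_prod _ (hF.comp_quasiMeasurePreserving hassoc.quasiMeasurePreserving)

theorem ae_spaceTime_slice {u : SpaceTime → ℂ} (hu : MemLp u 2) :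
    ∀ᵐ z : Plane, MemLp (fun y : Torus => u (z.fst, z.snd, y)) 2 := by
  have hassoc : MeasurePreserving
      (MeasurableEquiv.prodAssoc : (ℝ × ℝ) × Torus ≃ᵐ ℝ × ℝ × Torus) volume volume :=
    measurePreserving_prodAssoc volume volume volume
  have hv : MemLp (fun p : (ℝ × ℝ) × Torus => u (p.1.1, p.1.2, p.2)) 2 volume :=
    hu.comp_measurePreserving hassoc
  have h1 : ∀ᵐ p : ℝ × ℝ, AEStronglyMeasurable (fun y : Torus => u (p.1, p.2, y)) volume :=
    hv.1.prodMk_left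
  have h2 := (eLpNorm_lt_top_iff_lintegral_rpow_enorm_lt_top (by norm_num) (by norm_num)).1 hv.2
  have h3 : ∀ᵐ p : ℝ × ℝ, ∫⁻ y : Torus, ‖u (p.1, p.2, y)‖ₑ ^ (2 : ℝ≥0∞).toReal < ∞ := by
    refine ae_lt_top' (hv.1.enorm.pow_const _).lintegral_prod_right' ?_
    rw [← lintegral_prod _ (hv.1.enorm.pow_const _)]
    exact h2.ne
  have h4 : ∀ᵐ p : ℝ × ℝ, MemLp (fun y : Torus => u (p.1, p.2, y)) 2 := by
    filter_upwards [h1, h3] with p hp1 hp3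
    exact ⟨hp1, (eLpNorm_lt_top_iff_lintegral_rpow_enorm_lt_top (by norm_num) (by norm_num)).2 hp3⟩
  exact (WithLp.volume_preserving_ofLp ℝ ℝ).quasiMeasurePreserving.ae h4

theorem lintegral_torus (F : Torus → ℝ≥0∞) :
    ∫⁻ y, F y = ENNReal.ofReal (2 * π) * ∫⁻ y, F y ∂AddCircle.haarAddCircle := by
  rw [AddCircle.volume_eq_smul_haarAddCircle, lintegral_smul_measure, smul_eq_mul]

theorem integral_torus (f : Torus → ℂ) :
    ∫ y, f y = 2 * π * ∫ y, f y ∂AddCircle.haarAddCircle := by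
  rw [AddCircle.volume_eq_smul_haarAddCircle, integral_smul_measure,
    ENNReal.toReal_ofReal Real.two_pi_pos.le]
  simp

theorem enorm_two_pi_mul (c : ℂ) : ‖2 * π * c‖ₑ = ENNReal.ofReal (2 * π) * ‖c‖ₑ := by
  rw [enorm_mul, ← ofReal_norm]
  congr 2
  simp [abs_of_pos Real.pi_pos]

theorem fourierInv_sum {ι : Type*} (s : Finset ι) {f : ι → Plane → ℂ}
    (hf : ∀ i, Integrable (f i)) (z : Plane) : 𝓕⁻ (∑ i ∈ s, f i) z = ∑ i ∈ s, 𝓕⁻ (f i) z := by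
  simp only [Real.fourierInv_eq_fourier_neg, Real.fourier_eq, Finset.sum_apply, Finset.smul_sum]
  exact integral_finsetSum _ fun i _ => (Real.fourierIntegral_convergent_iff _).2 (hf i)

/-- Parseval's identity on the torus of length `2π`. -/
theorem lintegral_sq_torus {f : Torus → ℂ} (hf : MemLp f 2) :
    ∫⁻ y, ‖f y‖ₑ ^ 2 =
      (ENNReal.ofReal (2 * π))⁻¹ * ∑' q : ℤ, ‖∫ y : Torus, fourier (-q) y * f y‖ₑ ^ 2 := by
  have hf' : MemLp f 2 AddCircle.haarAddCircle := memLp_haarAddCircle_iff.2 hf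
  have hsum := hasSum_sq_fourierCoeff (hf'.toLp f)
  have hc : ∀ q, fourierCoeff (hf'.toLp f) q = fourierCoeff f q := fun q => by
    rw [fourierCoeff_congr_ae hf'.coeFn_toLp]
  simp only [hc] at hsum
  have h1 : ∫⁻ y, ‖f y‖ₑ ^ 2 ∂AddCircle.haarAddCircle = ∑' q : ℤ, ‖fourierCoeff f q‖ₑ ^ 2 := by
    have e1 : ∑' q : ℤ, ‖fourierCoeff f q‖ₑ ^ 2 =
        ENNReal.ofReal (∫ y, ‖(hf'.toLp f) y‖ ^ 2 ∂AddCircle.haarAddCircle) := by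
      rw [← hsum.tsum_eq, ENNReal.ofReal_tsum_of_nonneg (fun q => by positivity) hsum.summable]
      refine tsum_congr fun q => ?_
      rw [ENNReal.ofReal_pow (norm_nonneg _), ofReal_norm]
    rw [e1, ofReal_integral_eq_lintegral_ofReal ((Lp.memLp _).integrable_norm_pow (by norm_num))
      (Filter.Eventually.of_forall fun y => by positivity)]
    refine lintegral_congr_ae ?_
    filter_upwards [hf'.coeFn_toLp] with y hy
    rw [hy, ENNReal.ofReal_pow (norm_nonneg _), ofReal_norm]
  have h2 : ∀ q : ℤ, ∫ y : Torus, fourier (-q) y * f y = 2 * π * fourierCoeff f q := fun q => by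
    rw [integral_torus]; rfl
  have hpi : ENNReal.ofReal (2 * π) ≠ 0 := by simp [Real.pi_pos]
  simp only [h2, enorm_two_pi_mul, mul_pow]
  rw [lintegral_torus, h1, ENNReal.tsum_mul_left, ← mul_assoc, sq, ← mul_assoc,
    ENNReal.inv_mul_cancel hpi ENNReal.ofReal_ne_top, one_mul]

theorem lintegral_sq_spaceTime {u : SpaceTime → ℂ} (hu : AEStronglyMeasurable u)
    (hslice : ∀ᵐ z : Plane, MemLp (fun y : Torus => u (z.fst, z.snd, y)) 2)
    (hcoeff : ∀ q, AEStronglyMeasurable (yCoeff u q)) :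
    ∫⁻ p, ‖u p‖ₑ ^ 2 = (ENNReal.ofReal (2 * π))⁻¹ * ∑' q : ℤ, ∫⁻ z, ‖yCoeff u q z‖ₑ ^ 2 := by
  rw [lintegral_spaceTime (hu.enorm.pow_const 2), ← lintegral_tsum fun q =>
    (hcoeff q).enorm.pow_const 2, ← lintegral_const_mul'' _
      (AEMeasurable.tsum fun q => (hcoeff q).enorm.pow_const 2)]
  refine lintegral_congr_ae ?_
  filter_upwards [hslice] with z hz
  exact lintegral_sq_torus hz

/-! ### From the `L⁴` norm to a convolution on the frequency side -/

/-- The function with partial Fourier coefficients `2π 𝓕⁻ (g q)` for `q ∈ S`. -/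
def synthesis (S : Finset ℤ) (g : ℤ → Plane → ℂ) (p : SpaceTime) : ℂ :=
  ∑ q ∈ S, 𝓕⁻ (g q) (WithLp.toLp 2 (p.1, p.2.1)) * fourier q p.2.2

theorem continuous_synthesis (S : Finset ℤ) {g : ℤ → Plane → ℂ} (hg : ∀ q, Integrable (g q)) :
    Continuous (synthesis S g) := by
  unfold synthesis
  refine continuous_finsetSum _ fun q _ => ?_
  have h1 : Continuous fun p : SpaceTime => (WithLp.toLp 2 (p.1, p.2.1) : Plane) :=
    (WithLp.prod_continuous_toLp 2 ℝ ℝ).comp (by fun_prop)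
  have h2 : Continuous fun p : SpaceTime => fourier q p.2.2 := by fun_prop
  exact ((continuous_fourierInv (hg q)).comp h1).mul h2

theorem integral_fourier_torus (n : ℤ) :
    ∫ y : Torus, fourier n y = if n = 0 then (2 * π : ℂ) else 0 := by
  have h := congrFun (fourierCoeff_fourier (T := 2 * π) n) 0
  rw [integral_torus]
  have h' : fourierCoeff (fourier n : Torus → ℂ) 0 =
      ∫ y : Torus, fourier n y ∂AddCircle.haarAddCircle := by
    simp [fourierCoeff]
  rw [← h', h]
  rcases eq_or_ne n 0 with rfl | hn
  · simp
  · simp [hn, hn.symm]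

theorem yCoeff_synthesis (S : Finset ℤ) (g : ℤ → Plane → ℂ) (hS : ∀ q ∉ S, g q = 0) (q : ℤ)
    (z : Plane) : yCoeff (synthesis S g) q z = 2 * π * 𝓕⁻ (g q) z := by
  have hz : ∀ q ∉ S, 𝓕⁻ (g q) z = 0 := fun q hq => by
    rw [hS q hq]; simp [Real.fourierInv_eq]
  calc yCoeff (synthesis S g) q z
      = ∫ y : Torus, ∑ n ∈ S, 𝓕⁻ (g n) z * fourier (n - q) y := by
        unfold yCoeff synthesis
        congr 1; funext y
        rw [Finset.mul_sum]
        refine Finset.sum_congr rfl fun n _ => ?_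
        rw [sub_eq_add_neg, fourier_add]
        show _ * (𝓕⁻ (g n) z * _) = _
        ring
    _ = ∑ n ∈ S, 𝓕⁻ (g n) z * ∫ y : Torus, fourier (n - q) y := by
        rw [integral_finsetSum]
        · simp only [integral_const_mul]
        · intro n _
          exact (Continuous.integrable_of_hasCompactSupport (by fun_prop)
            (HasCompactSupport.of_compactSpace _)).const_mul _
    _ = 2 * π * 𝓕⁻ (g q) z := by
        simp only [integral_fourier_torus, sub_eq_zero, mul_ite, mul_zero, Finset.sum_ite_eq']
        split_ifs with h
        · ring
        · rw [hz q h, mul_zero]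

/-- Expanding one factor only leaves a coefficient of the other, at `q - n`. Vanishing of `g` off
`S` removes any need to ask whether `q - n ∈ S`. -/
theorem yCoeff_synthesis_sq (S : Finset ℤ) (g : ℤ → Plane → ℂ) (hS : ∀ q ∉ S, g q = 0) (q : ℤ)
    (z : Plane) : yCoeff (fun p => synthesis S g p ^ 2) q z =
      2 * π * ∑ n ∈ S, 𝓕⁻ (g n) z * 𝓕⁻ (g (q - n)) z := by
  have hsq : ∀ y : Torus, fourier (-q) y * synthesis S g (z.fst, z.snd, y) ^ 2 =
      ∑ n ∈ S, 𝓕⁻ (g n) z * (fourier (-(q - n)) y * synthesis S g (z.fst, z.snd, y)) := by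
    intro y
    have h1 : synthesis S g (z.fst, z.snd, y) = ∑ n ∈ S, 𝓕⁻ (g n) z * fourier n y := rfl
    rw [sq]
    nth_rewrite 1 [h1]
    rw [Finset.sum_mul, Finset.mul_sum]
    refine Finset.sum_congr rfl fun n _ => ?_
    rw [show -(q - n) = -q + n by ring, fourier_add]
    ring
  have hcont : Continuous fun y : Torus => synthesis S g (z.fst, z.snd, y) := by
    unfold synthesis
    refine continuous_finsetSum _ fun n _ => ?_
    change Continuous fun y : Torus => 𝓕⁻ (g n) z * fourier n y
    fun_prop
  unfold yCoeff
  simp only [hsq]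
  rw [integral_finsetSum, Finset.mul_sum]
  · refine Finset.sum_congr rfl fun n _ => ?_
    rw [integral_const_mul]
    have := yCoeff_synthesis S g hS (q - n) z
    unfold yCoeff at this
    rw [this]; ring
  · intro n _
    exact (Continuous.integrable_of_hasCompactSupport ((map_continuous _).mul hcont)
      (HasCompactSupport.of_compactSpace _)).const_mul _

/-- The reduction of the `L⁴` bound to an `L²` bound for a convolution. -/
theorem lintegral_synthesis_pow_four_le (S : Finset ℤ) (g : ℤ → Plane → ℂ) (hS : ∀ q ∉ S, g q = 0)
    (hg : ∀ q, Integrable (g q)) (hgm : ∀ q, Measurable (g q)) :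
    ∫⁻ p, ‖synthesis S g p‖ₑ ^ 4 ≤ ENNReal.ofReal (2 * π) *
      ∫⁻ w : Plane × ℤ, (∫⁻ z : Plane × ℤ, ‖g z.2 z.1‖ₑ * ‖g (w - z).2 (w - z).1‖ₑ
        ∂(volume.prod Measure.count)) ^ 2 ∂(volume.prod Measure.count) := by
  have hcont := continuous_synthesis S hg
  have hF : Measurable fun z : Plane × ℤ => ‖g z.2 z.1‖ₑ :=
    measurable_from_prod_countable_left fun q => (hgm q).enorm
  have hsub : Measurable fun p : (Plane × ℤ) × (Plane × ℤ) => p.1 - p.2 := by fun_prop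
  have hpi : ENNReal.ofReal (2 * π) ≠ 0 := by simp [Real.pi_pos]
  set H : ℤ → Plane → ℂ := fun q => ∑ n ∈ S,
    convolution (g n) (g (q - n)) (ContinuousLinearMap.mul ℂ ℂ) volume with hH
  have hHint : ∀ q, Integrable (H q) := fun q => integrable_finsetSum' _ fun n _ =>
    (hg n).integrable_convolution _ (hg _)
  have hHF : ∀ q z, ∑ n ∈ S, 𝓕⁻ (g n) z * 𝓕⁻ (g (q - n)) z = 𝓕⁻ (H q) z := by
    intro q z
    simp only [fourierInv_mul_fourierInv (hg _) (hg _), hH]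
    rw [fourierInv_sum _ fun n => (hg n).integrable_convolution _ (hg _)]
  have hHle : ∀ q w, ‖H q w‖ₑ ≤ ∫⁻ z : Plane × ℤ, ‖g z.2 z.1‖ₑ * ‖g ((w, q) - z).2 ((w, q) - z).1‖ₑ
        ∂(volume.prod Measure.count) := by
    intro q w
    have hm : Measurable fun z : Plane × ℤ =>
        ‖g z.2 z.1‖ₑ * ‖g ((w, q) - z).2 ((w, q) - z).1‖ₑ :=
      hF.mul (hF.comp (hsub.comp (measurable_const.prodMk measurable_id)))
    rw [lintegral_prod_symm _ hm.aemeasurable, lintegral_count]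
    calc ‖H q w‖ₑ ≤ ∑ n ∈ S, ‖convolution (g n) (g (q - n)) (ContinuousLinearMap.mul ℂ ℂ) volume w‖ₑ := by
          simp only [hH, Finset.sum_apply]; exact enorm_sum_le _ _
      _ ≤ ∑ n ∈ S, ∫⁻ x, ‖g n x‖ₑ * ‖g (q - n) (w - x)‖ₑ := by
          refine Finset.sum_le_sum fun n _ => ?_
          refine (enorm_integral_le_lintegral_enorm _).trans (le_of_eq ?_)
          simp
      _ ≤ _ := ENNReal.sum_le_tsum _
  calc ∫⁻ p, ‖synthesis S g p‖ₑ ^ 4 = ∫⁻ p, ‖synthesis S g p ^ 2‖ₑ ^ 2 := by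
        simp only [enorm_pow, ← pow_mul]
    _ = (ENNReal.ofReal (2 * π))⁻¹ *
        ∑' q : ℤ, ∫⁻ z, ‖yCoeff (fun p => synthesis S g p ^ 2) q z‖ₑ ^ 2 := by
        refine lintegral_sq_spaceTime (hcont.pow 2).aestronglyMeasurable ?_ fun q => ?_
        · refine Filter.Eventually.of_forall fun z => ?_
          refine Continuous.memLp_of_hasCompactSupport ?_ (HasCompactSupport.of_compactSpace _)
          exact (hcont.comp (by fun_prop)).pow 2
        · have : yCoeff (fun p => synthesis S g p ^ 2) q = fun z => 2 * π * 𝓕⁻ (H q) z := by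
            funext z; rw [yCoeff_synthesis_sq S g hS, hHF]
          rw [this]
          exact (continuous_const.mul (continuous_fourierInv (hHint q))).aestronglyMeasurable
    _ = ENNReal.ofReal (2 * π) * ∑' q : ℤ, ∫⁻ z, ‖𝓕⁻ (H q) z‖ₑ ^ 2 := by
        simp only [yCoeff_synthesis_sq S g hS, hHF, enorm_two_pi_mul, mul_pow]
        simp only [lintegral_const_mul' _ _ (ENNReal.pow_ne_top ENNReal.ofReal_ne_top)]
        rw [ENNReal.tsum_mul_left, ← mul_assoc, sq, ← mul_assoc,
          ENNReal.inv_mul_cancel hpi ENNReal.ofReal_ne_top, one_mul]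
    _ ≤ ENNReal.ofReal (2 * π) * ∑' q : ℤ, ∫⁻ w, (∫⁻ z : Plane × ℤ,
        ‖g z.2 z.1‖ₑ * ‖g ((w, q) - z).2 ((w, q) - z).1‖ₑ ∂(volume.prod Measure.count)) ^ 2 := by
        refine mul_le_mul' le_rfl (ENNReal.tsum_le_tsum fun q => ?_)
        refine (lintegral_fourierInv_sq_le (hHint q)).trans (lintegral_mono fun w => ?_)
        dsimp only
        gcongr
        exact hHle q w
    _ = _ := by
        rw [lintegral_prod_symm, lintegral_count]
        refine (Measurable.pow_const ?_ 2).aemeasurable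
        refine Measurable.lintegral_prod_right' (f := fun p : (Plane × ℤ) × (Plane × ℤ) =>
          ‖g p.2.2 p.2.1‖ₑ * ‖g (p.1 - p.2).2 (p.1 - p.2).1‖ₑ) ?_
        exact (hF.comp measurable_snd).mul (hF.comp hsub)

/-! ### The `L⁴` estimate for bounded frequencies -/

/-- The weight `⟨q⟩^{-2ε} ⟨τ - φ(ξ, q)⟩^{-2b}` restricted to the frequencies in `S`, as a function of
the variables `(τ, ξ) / 2π` of Mathlib's Fourier transform. -/
def freqWeight (S : Set (ℝ × ℤ)) (ε b : ℝ) (z : Plane × ℤ) : ℝ≥0∞ :=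
  S.indicator (fun p => decay ε p.2 * decay b (2 * π * z.1.fst - phase p.1 p.2))
    (2 * π * z.1.snd, z.2)

theorem measurable_fst_plane : Measurable fun z : Plane × ℤ => z.1.fst :=
  (measurable_fst.comp (WithLp.measurable_ofLp 2 (ℝ × ℝ))).comp measurable_fst

theorem measurable_snd_plane : Measurable fun z : Plane × ℤ => z.1.snd :=
  (measurable_snd.comp (WithLp.measurable_ofLp 2 (ℝ × ℝ))).comp measurable_fst

theorem measurable_modulation :
    Measurable fun z : Plane × ℤ => 2 * π * z.1.fst - phase (2 * π * z.1.snd) z.2 := by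
  have h1 := measurable_fst_plane
  have h2 := measurable_snd_plane
  unfold phase; fun_prop

theorem measurable_freqWeight {S : Set (ℝ × ℤ)} (hS : MeasurableSet S) (ε b : ℝ) :
    Measurable (freqWeight S ε b) := by
  have h : freqWeight S ε b = ((fun z : Plane × ℤ => (2 * π * z.1.snd, z.2)) ⁻¹' S).indicator
      (fun z => decay ε z.2 * decay b (2 * π * z.1.fst - phase (2 * π * z.1.snd) z.2)) := by
    funext z; rfl
  rw [h]
  have h2 := measurable_snd_plane
  refine Measurable.indicator ?_ (hS.preimage (by fun_prop))
  exact Measurable.mul (by fun_prop) ((measurable_decay b).comp measurable_modulation)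

theorem freqWeight_sq (S : Set (ℝ × ℤ)) (ε b : ℝ) (z : Plane × ℤ) :
    freqWeight S (ε / 2) (b / 2) z ^ 2 = freqWeight S ε b z := by
  unfold freqWeight
  by_cases h : (2 * π * z.1.snd, z.2) ∈ S
  · simp only [Set.indicator_of_mem h]
    rw [mul_pow, sq, sq, decay_mul_decay, decay_mul_decay, add_halves, add_halves]
  · simp [Set.indicator_of_notMem h]

theorem measurable_pairWeight {S : Set (ℝ × ℤ)} (hS : MeasurableSet S) (ε b τ ξ : ℝ) (q : ℤ) :
    Measurable (pairWeight S ε b τ ξ q) := by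
  unfold pairWeight phase
  exact Measurable.indicator (by fun_prop) (hS.inter (hS.preimage (by fun_prop)))

theorem lintegral_decay_conv_scaled_le {b : ℝ} (hb : 0 ≤ b) (T r s : ℝ) :
    ∫⁻ t, decay b (2 * π * t - r) * decay b (T - 2 * π * t - s) ≤
      ENNReal.ofReal |(2 * π)⁻¹| * (ENNReal.ofReal (4 ^ b) * (2 * ∫⁻ x, decay b x)) *
        decay b (T - r - s) := by
  have h := lintegral_comp_mul_add (fun x => decay b (x - r) * decay b ((T - s) - x))
    (by fun_prop) Real.two_pi_pos.ne' 0
  simp only [add_zero] at h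
  calc _ = ∫⁻ t, decay b (2 * π * t - r) * decay b ((T - s) - 2 * π * t) := by
        simp only [sub_right_comm]
    _ ≤ _ := by
        rw [h, mul_assoc, sub_right_comm]
        exact mul_le_mul' le_rfl (lintegral_decay_conv_le hb _ _)

theorem freqWeight_mk (S : Set (ℝ × ℤ)) (ε b t x : ℝ) (n : ℤ) :
    freqWeight S ε b (WithLp.toLp 2 (t, x), n) =
      S.indicator (fun p => decay ε p.2 * decay b (2 * π * t - phase p.1 p.2)) (2 * π * x, n) :=
  rfl

theorem freqWeight_sub_mk (S : Set (ℝ × ℤ)) (ε b t x : ℝ) (n : ℤ) (w : Plane × ℤ) :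
    freqWeight S ε b (w - (WithLp.toLp 2 (t, x), n)) =
      S.indicator (fun p => decay ε p.2 * decay b (2 * π * w.1.fst - 2 * π * t - phase p.1 p.2))
        (2 * π * w.1.snd - 2 * π * x, w.2 - n) := by
  rw [← mul_sub, ← mul_sub]
  rfl

/-- For fixed `(ξ₁, q₁)` the integral in `τ₁` convolves the two modulation weights into one, at `τ -
φ(ξ₁, q₁) - φ(ξ - ξ₁, q - q₁)`. What remains is `pairKernel`, up to the Jacobians of the rescaling
by `2π`. -/
theorem lintegral_freqWeight_conv_le {S : Set (ℝ × ℤ)} (hS : MeasurableSet S) {ε b : ℝ}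
    (hb : 0 ≤ b) {C : ℝ≥0∞} (hC : ∀ τ ξ q, pairKernel S ε b τ ξ q ≤ C) (w : Plane × ℤ) :
    ∫⁻ z, freqWeight S ε b z * freqWeight S ε b (w - z) ∂(volume.prod Measure.count) ≤
      ENNReal.ofReal |(2 * π)⁻¹| * (ENNReal.ofReal (4 ^ b) * (2 * ∫⁻ x, decay b x)) *
      (ENNReal.ofReal |(2 * π)⁻¹| * C) := by
  classical
  set c := ENNReal.ofReal |(2 * π)⁻¹|
  set D := ENNReal.ofReal (4 ^ b) * (2 * ∫⁻ x, decay b x)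
  have hsub : Measurable fun z : Plane × ℤ => w - z := by fun_prop
  have hm : Measurable fun z : Plane × ℤ => freqWeight S ε b z * freqWeight S ε b (w - z) :=
    (measurable_freqWeight hS ε b).mul ((measurable_freqWeight hS ε b).comp hsub)
  have key : ∀ n : ℤ, ∫⁻ z : Plane, freqWeight S ε b (z, n) * freqWeight S ε b (w - (z, n)) ≤
      c * D * (c * ∫⁻ x, pairWeight S ε b (2 * π * w.1.fst) (2 * π * w.1.snd) w.2 (x, n)) := by
    intro n
    set F : ℝ × ℝ → ℝ≥0∞ := fun p => freqWeight S ε b (WithLp.toLp 2 p, n) *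
      freqWeight S ε b (w - (WithLp.toLp 2 p, n)) with hF
    have hFm : Measurable F := hm.comp
      ((WithLp.measurable_toLp 2 (ℝ × ℝ)).prodMk measurable_const)
    have hpm : Measurable fun x =>
        pairWeight S ε b (2 * π * w.1.fst) (2 * π * w.1.snd) w.2 (x, n) :=
      (measurable_pairWeight hS _ _ _ _ _).comp (by fun_prop)
    have hpm' : Measurable fun x =>
        pairWeight S ε b (2 * π * w.1.fst) (2 * π * w.1.snd) w.2 (2 * π * x, n) :=
      (measurable_pairWeight hS _ _ _ _ _).comp (by fun_prop)
    have hscale := lintegral_comp_mul_add _ hpm Real.two_pi_pos.ne' 0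
    simp only [add_zero] at hscale
    calc _ = ∫⁻ p, F p := lintegral_plane F
      _ = ∫⁻ x, ∫⁻ t, F (t, x) := lintegral_prod_symm _ hFm.aemeasurable
      _ ≤ ∫⁻ x, c * D *
          pairWeight S ε b (2 * π * w.1.fst) (2 * π * w.1.snd) w.2 (2 * π * x, n) := by
          refine lintegral_mono fun x => ?_
          simp only [hF, freqWeight_mk, freqWeight_sub_mk]
          rw [pairWeight_apply]
          by_cases h1 : (2 * π * x, n) ∈ S
          · by_cases h2 : (2 * π * w.1.snd - 2 * π * x, w.2 - n) ∈ S
            · simp only [Set.indicator_of_mem h1, Set.indicator_of_mem h2]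
              rw [if_pos ⟨h1, h2⟩]
              simp only [mul_mul_mul_comm (decay ε n)]
              rw [lintegral_const_mul' _ _
                (ENNReal.mul_ne_top (decay_ne_top _ _) (decay_ne_top _ _)), mul_left_comm (c * D)]
              exact mul_le_mul' le_rfl (lintegral_decay_conv_scaled_le hb _ _ _)
            · simp [Set.indicator_of_notMem h2]
          · simp [Set.indicator_of_notMem h1]
      _ = _ := by rw [lintegral_const_mul _ hpm', hscale]
  rw [lintegral_prod_symm _ hm.aemeasurable, lintegral_count]
  refine (ENNReal.tsum_le_tsum key).trans ?_
  rw [ENNReal.tsum_mul_left, ENNReal.tsum_mul_left]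
  gcongr
  exact hC _ _ _

/-- The square of the Bourgain norm of the function with Fourier coefficients `g`, with the weight
`⟨q⟩` in place of `⟨(ξ, q)⟩`. -/
def weightedEnergy (ε b : ℝ) (g : ℤ → Plane → ℂ) : ℝ≥0∞ :=
  ∫⁻ z : Plane × ℤ, decay (-ε) z.2 * decay (-b) (2 * π * z.1.fst - phase (2 * π * z.1.snd) z.2) *
    ‖g z.2 z.1‖ₑ ^ 2 ∂(volume.prod Measure.count)

/-- The `L⁴` estimate for frequencies in one cone. -/
theorem exists_lintegral_synthesis_le {S : Set (ℝ × ℤ)} (hS : MeasurableSet S) {ε b : ℝ}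
    (hb : 1 / 2 < b) (hC : ∃ C < ∞, ∀ τ ξ q, pairKernel S ε b τ ξ q ≤ C) :
    ∃ C < ∞, ∀ (A : Finset ℤ) (g : ℤ → Plane → ℂ), (∀ q ∉ A, g q = 0) →
      (∀ q, Integrable (g q)) → (∀ q, Measurable (g q)) →
      (∀ q z, (2 * π * z.snd, q) ∉ S → g q z = 0) →
      ∫⁻ p, ‖synthesis A g p‖ₑ ^ 4 ≤ C * weightedEnergy ε b g ^ 2 := by
  obtain ⟨C, hC, h⟩ := hC
  have hfin := (lintegral_decay_lt_top hb).ne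
  refine ⟨ENNReal.ofReal (2 * π) *
    (ENNReal.ofReal |(2 * π)⁻¹| * (ENNReal.ofReal (4 ^ b) * (2 * ∫⁻ x, decay b x)) *
      (ENNReal.ofReal |(2 * π)⁻¹| * C)), by finiteness, fun A g hA hg hgm hsupp => ?_⟩
  set σ : Plane × ℤ → ℝ := fun z => 2 * π * z.1.fst - phase (2 * π * z.1.snd) z.2 with hσ
  -- `f` is `‖g‖` with the weight divided out, so `‖g‖ = f v` with `v` the square root of
  -- `freqWeight S ε b`, and `∫ f²` is the energy.
  set f : Plane × ℤ → ℝ≥0∞ := fun z =>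
    ‖g z.2 z.1‖ₑ * (decay (-(ε / 2)) z.2 * decay (-(b / 2)) (σ z)) with hf
  have hF : Measurable fun z : Plane × ℤ => ‖g z.2 z.1‖ₑ :=
    measurable_from_prod_countable_left fun q => (hgm q).enorm
  have hfm : Measurable f := hF.mul (Measurable.mul (by fun_prop)
    ((measurable_decay _).comp measurable_modulation))
  have hcancel : ∀ p s : ℝ, decay (-p) s * decay p s = 1 := by
    intro p s; rw [decay_mul_decay]; simp [decay]
  have hfv : ∀ z, ‖g z.2 z.1‖ₑ = f z * freqWeight S (ε / 2) (b / 2) z := by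
    intro z
    by_cases hz : (2 * π * z.1.snd, z.2) ∈ S
    · rw [freqWeight, Set.indicator_of_mem hz]
      calc ‖g z.2 z.1‖ₑ = ‖g z.2 z.1‖ₑ * ((decay (-(ε / 2)) z.2 * decay (ε / 2) z.2) *
            (decay (-(b / 2)) (σ z) * decay (b / 2) (σ z))) := by
            rw [hcancel, hcancel, one_mul, mul_one]
        _ = _ := by simp only [hf, hσ]; ring
    · rw [hsupp _ _ hz, freqWeight, Set.indicator_of_notMem hz]; simp
  have hf2 : ∫⁻ z, f z ^ 2 ∂(volume.prod Measure.count) = weightedEnergy ε b g := by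
    refine lintegral_congr fun z => ?_
    simp only [hf, hσ, mul_pow]
    rw [sq (decay _ _), sq (decay _ _), decay_mul_decay, decay_mul_decay,
      show -(ε / 2) + -(ε / 2) = -ε by ring, show -(b / 2) + -(b / 2) = -b by ring, mul_comm]
  refine (lintegral_synthesis_pow_four_le A g hA hg hgm).trans ?_
  rw [mul_assoc, ← hf2]
  refine mul_le_mul' le_rfl ?_
  simp only [hfv]
  refine lintegral_conv_sq_le _ hfm (measurable_freqWeight hS _ _) fun w => ?_
  simp only [freqWeight_sq]
  exact lintegral_freqWeight_conv_le hS (by linarith) h w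

theorem synthesis_sum {ι : Type*} (s : Finset ι) (A : Finset ℤ) {g : ι → ℤ → Plane → ℂ}
    (hg : ∀ i q, Integrable (g i q)) (p : SpaceTime) :
    synthesis A (fun q => ∑ i ∈ s, g i q) p = ∑ i ∈ s, synthesis A (g i) p := by
  unfold synthesis
  rw [Finset.sum_comm]
  refine Finset.sum_congr rfl fun q _ => ?_
  rw [fourierInv_sum s fun i => hg i q, Finset.sum_mul]

theorem weightedEnergy_mono {ε b : ℝ} {g h : ℤ → Plane → ℂ}
    (hgh : ∀ q z, ‖g q z‖ₑ ≤ ‖h q z‖ₑ) : weightedEnergy ε b g ≤ weightedEnergy ε b h := by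
  refine lintegral_mono fun z => ?_
  dsimp only
  gcongr
  exact hgh _ _

/-- The `L⁴` estimate for functions whose Fourier transform has bounded support. -/
theorem exists_eLpNorm_synthesis_le {ε b : ℝ} (hε : 0 < ε) (hb : 1 / 2 < b) (hb1 : b ≤ 1) :
    ∃ C < ∞, ∀ (A : Finset ℤ) (g : ℤ → Plane → ℂ), (∀ q ∉ A, g q = 0) →
      (∀ q, Integrable (g q)) → (∀ q, Measurable (g q)) →
      eLpNorm (synthesis A g) 4 volume ≤ C * weightedEnergy ε b g ^ (1 / 2 : ℝ) := by
  classical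
  choose C hC h using fun j => exists_lintegral_synthesis_le
    (measurable_coneIndex (measurableSet_singleton j)) hb (exists_pairKernel_le j hε hb hb1)
  refine ⟨∑ j, C j ^ (1 / 4 : ℝ), ?_, fun A g hA hg hgm => ?_⟩
  · exact ENNReal.sum_lt_top.2 fun j _ => ENNReal.rpow_lt_top_of_nonneg (by norm_num) (hC j).ne
  -- Sharp cutoffs to the eight cones do not increase the energy, and `g` is the sum of its pieces.
  set B : Bool × Bool × Bool → ℤ → Set Plane := fun j q =>
    {z | coneIndex (2 * π * z.snd, q) = j} with hB
  have hBm : ∀ j q, MeasurableSet (B j q) := by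
    intro j q
    have hm : Measurable fun z : Plane => (2 * π * z.snd, q) :=
      (measurable_const.mul (measurable_snd.comp (WithLp.measurable_ofLp 2 (ℝ × ℝ)))).prodMk
        measurable_const
    exact (measurable_coneIndex.comp hm) (measurableSet_singleton j)
  set gj : Bool × Bool × Bool → ℤ → Plane → ℂ := fun j q => (B j q).indicator (g q) with hgj
  have hgint : ∀ j q, Integrable (gj j q) := fun j q => (hg q).indicator (hBm j q)
  have hsum : (fun q => ∑ j, gj j q) = g := by
    funext q z
    simp [hgj, hB, Finset.sum_apply, Set.indicator_apply]
  have hsynth : synthesis A g = ∑ j, synthesis A (gj j) := by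
    funext p
    rw [Finset.sum_apply, ← synthesis_sum _ _ hgint, hsum]
  have hj : ∀ j, eLpNorm (synthesis A (gj j)) 4 volume ≤
      C j ^ (1 / 4 : ℝ) * weightedEnergy ε b g ^ (1 / 2 : ℝ) := by
    intro j
    have h1 := h j A (gj j) (fun q hq => by simp [hgj, hA q hq]) (hgint j)
      (fun q => (hgm q).indicator (hBm j q)) (fun q z hz => Set.indicator_of_notMem (s := B j q) hz _)
    have h2 : weightedEnergy ε b (gj j) ≤ weightedEnergy ε b g :=
      weightedEnergy_mono fun q z => by
        simp only [hgj]; exact enorm_indicator_le_enorm_self _ _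
    rw [eLpNorm_eq_lintegral_rpow_enorm_toReal (by norm_num) (by norm_num)]
    have h4 : (4 : ℝ≥0∞).toReal = 4 := by norm_num
    rw [h4]
    calc _ = (∫⁻ p, ‖synthesis A (gj j) p‖ₑ ^ 4) ^ (1 / 4 : ℝ) := by
          congr 2; funext p; exact_mod_cast ENNReal.rpow_natCast _ 4
      _ ≤ (C j * weightedEnergy ε b g ^ 2) ^ (1 / 4 : ℝ) := by
          gcongr
          exact h1.trans (by gcongr)
      _ = _ := by
          rw [ENNReal.mul_rpow_of_nonneg _ _ (by norm_num), ← ENNReal.rpow_natCast,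
            ← ENNReal.rpow_mul]
          norm_num
  rw [hsynth, Finset.sum_mul]
  refine (eLpNorm_sum_le (fun j _ => (continuous_synthesis A (hgint j)).aestronglyMeasurable)
    (by norm_num)).trans ?_
  exact Finset.sum_le_sum fun j _ => hj j

/-! ### Comparison with the Bourgain norm -/

/-- The Fourier transform on the plane of the `q`-th Fourier coefficient. -/
def planeTransform (u : Lp ℂ 2 (volume : Measure SpaceTime)) (q : ℤ) :
    Lp ℂ 2 (volume : Measure Plane) :=
  𝓕 ((memLp_yCoeff (Lp.memLp u) q).toLp (yCoeff u q))

theorem measurable_planeTransform (u : Lp ℂ 2 (volume : Measure SpaceTime)) (q : ℤ) :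
    Measurable (planeTransform u q) :=
  (Lp.stronglyMeasurable _).measurable

/-- Only `⟨q⟩ ≤ ⟨(ξ, q)⟩` is used of the spatial weight; the exponent `b` may be lowered because the
bracket is at least `1`. -/
theorem decay_neg_le_bracket {ε b b' : ℝ} (hε : 0 ≤ ε) (hb : b' ≤ b) (τ ξ : ℝ) (q : ℤ) :
    decay (-ε) q * decay (-b') (τ - phase ξ q) ≤
      ENNReal.ofReal (bracket₂ ξ q ^ (2 * ε) * bracket (τ - phase ξ q) ^ (2 * b)) := by
  unfold decay bracket₂ bracket
  rw [← ENNReal.ofReal_mul (by positivity)]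
  apply ENNReal.ofReal_le_ofReal
  have hs : ∀ x p : ℝ, 0 ≤ x → √x ^ (2 * p) = x ^ p := by
    intro x p hx
    rw [Real.sqrt_eq_rpow, ← Real.rpow_mul hx]; congr 1; ring
  rw [hs _ _ (by positivity), hs _ _ (by positivity), neg_neg, neg_neg]
  gcongr
  · nlinarith [sq_nonneg ξ]
  · nlinarith [sq_nonneg (τ - phase ξ q)]

theorem lintegral_comp_two_pi_smul (h : ℝ × ℝ → ℝ≥0∞) :
    ∫⁻ p : ℝ × ℝ, h (2 * π * p.1, 2 * π * p.2) =
      ENNReal.ofReal |((2 * π) ^ 2)⁻¹| * ∫⁻ p, h p := by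
  have hpi : 2 * π ≠ 0 := Real.two_pi_pos.ne'
  have h1 := Measure.map_addHaar_smul (volume : Measure (ℝ × ℝ)) hpi
  have h2 := lintegral_map_equiv (μ := (volume : Measure (ℝ × ℝ))) h
    (MeasurableEquiv.smul₀ (2 * π) hpi)
  rw [MeasurableEquiv.coe_smul₀, h1, lintegral_smul_measure, smul_eq_mul] at h2
  have h3 : ∫⁻ p : ℝ × ℝ, h (2 * π * p.1, 2 * π * p.2) = ∫⁻ p, h ((2 * π) • p) := rfl
  rw [h3, ← h2]
  simp

/-- The constant comes from the normalisation `(2π)^{-3/2}` and the substitution `(τ, ξ) ↦ 2π (τ,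
ξ)`. -/
theorem exists_weightedEnergy_le {ε b b' : ℝ} (hε : 0 ≤ ε) (hb : b' ≤ b) :
    ∃ C < ∞, ∀ u : Lp ℂ 2 (volume : Measure SpaceTime),
      weightedEnergy ε b' (fun q => planeTransform u q) ^ (1 / 2 : ℝ) ≤ C * bourgainNorm ε b u := by
  set c : ℝ≥0∞ := ‖((((2 * π) ^ (-(3 / 2) : ℝ) : ℝ)) : ℂ)‖ₑ ^ 2 with hc
  have hc0 : c ≠ 0 := by
    have : (0 : ℝ) < (2 * π) ^ (-(3 / 2) : ℝ) := by positivity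
    simp only [hc, ne_eq, pow_eq_zero_iff two_ne_zero, enorm_eq_zero, Complex.ofReal_eq_zero]
    exact this.ne'
  have hctop : c ≠ ∞ := ENNReal.pow_ne_top enorm_ne_top
  refine ⟨(c⁻¹ * ENNReal.ofReal |((2 * π) ^ 2)⁻¹|) ^ (1 / 2 : ℝ), ?_, fun u => ?_⟩
  · exact ENNReal.rpow_lt_top_of_nonneg (by norm_num)
      (ENNReal.mul_ne_top (ENNReal.inv_ne_top.2 hc0) ENNReal.ofReal_ne_top)
  rw [bourgainNorm, ← ENNReal.mul_rpow_of_nonneg _ _ (by norm_num)]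
  gcongr
  set h : ℝ × ℝ → ℝ≥0∞ := fun p => ∑' q : ℤ,
    ENNReal.ofReal (bracket₂ p.2 q ^ (2 * ε) * bracket (p.1 - phase p.2 q) ^ (2 * b)) *
      ‖fourierTransform u p.1 p.2 q‖ₑ ^ 2 with hh
  have hm : Measurable fun z : Plane × ℤ => decay (-ε) z.2 *
      decay (-b') (2 * π * z.1.fst - phase (2 * π * z.1.snd) z.2) *
        ‖planeTransform u z.2 z.1‖ₑ ^ 2 := by
    refine Measurable.mul (Measurable.mul (by fun_prop)
      ((measurable_decay _).comp measurable_modulation)) (Measurable.pow_const ?_ 2)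
    exact measurable_from_prod_countable_left fun q => (measurable_planeTransform u q).enorm
  calc weightedEnergy ε b' (fun q => planeTransform u q)
      = ∫⁻ p : ℝ × ℝ, ∑' q : ℤ, decay (-ε) q *
          decay (-b') (2 * π * p.1 - phase (2 * π * p.2) q) *
            ‖planeTransform u q (WithLp.toLp 2 p)‖ₑ ^ 2 := by
        rw [weightedEnergy, lintegral_prod _ hm.aemeasurable]
        simp only [lintegral_count]
        exact lintegral_plane fun p => ∑' q : ℤ, decay (-ε) q *
          decay (-b') (2 * π * p.1 - phase (2 * π * p.2) q) *
            ‖planeTransform u q (WithLp.toLp 2 p)‖ₑ ^ 2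
    _ ≤ ∫⁻ p : ℝ × ℝ, c⁻¹ * h (2 * π * p.1, 2 * π * p.2) := by
        refine lintegral_mono fun p => ?_
        simp only [hh]
        rw [← ENNReal.tsum_mul_left]
        refine ENNReal.tsum_le_tsum fun q => ?_
        have e : ‖fourierTransform u (2 * π * p.1) (2 * π * p.2) q‖ₑ ^ 2 =
            c * ‖planeTransform u q (WithLp.toLp 2 p)‖ₑ ^ 2 := by
          have hpi : 2 * π ≠ 0 := Real.two_pi_pos.ne'
          unfold fourierTransform
          rw [mul_div_cancel_left₀ _ hpi, mul_div_cancel_left₀ _ hpi, enorm_mul, mul_pow]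
          rfl
        rw [e, mul_left_comm, ← mul_assoc c⁻¹, ENNReal.inv_mul_cancel hc0 hctop, one_mul]
        gcongr
        exact decay_neg_le_bracket hε hb _ _ _
    _ = _ := by
        rw [lintegral_const_mul' _ _ (ENNReal.inv_ne_top.2 hc0), lintegral_comp_two_pi_smul,
          mul_assoc]

theorem coeFn_fourierInv_planeTransform (u : Lp ℂ 2 (volume : Measure SpaceTime)) (q : ℤ) :
    ((𝓕⁻ (planeTransform u q) : Lp ℂ 2 (volume : Measure Plane)) : Plane → ℂ) =ᵐ[volume]
      yCoeff u q := by
  rw [planeTransform, FourierTransform.fourierInv_fourier_eq]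
  exact MemLp.coeFn_toLp _

theorem lintegral_fourierInv_L2_sq (f : Lp ℂ 2 (volume : Measure Plane)) :
    ∫⁻ z, ‖(𝓕⁻ f : Lp ℂ 2 (volume : Measure Plane)) z‖ₑ ^ 2 = ∫⁻ z, ‖f z‖ₑ ^ 2 := by
  rw [lintegral_enorm_sq, lintegral_enorm_sq, ← Lp.enorm_def, ← Lp.enorm_def, ← ofReal_norm,
    ← ofReal_norm]
  congr 2
  exact (Lp.fourierTransformₗᵢ Plane ℂ).symm.norm_map _

theorem tsum_lintegral_planeTransform_sq_lt_top (u : Lp ℂ 2 (volume : Measure SpaceTime)) :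
    ∑' q : ℤ, ∫⁻ z, ‖planeTransform u q z‖ₑ ^ 2 < ∞ := by
  have hu := Lp.memLp u
  have h := lintegral_sq_spaceTime hu.1 (ae_spaceTime_slice hu) fun q => (memLp_yCoeff hu q).1
  have h2 : ∀ q, ∫⁻ z, ‖planeTransform u q z‖ₑ ^ 2 = ∫⁻ z, ‖yCoeff u q z‖ₑ ^ 2 := fun q => by
    rw [← lintegral_fourierInv_L2_sq]
    refine lintegral_congr_ae ?_
    filter_upwards [coeFn_fourierInv_planeTransform u q] with z hz
    rw [hz]
  simp only [h2]
  rw [lintegral_enorm_sq] at h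
  refine Ne.lt_top fun htop => ?_
  rw [htop, ENNReal.mul_top (ENNReal.inv_ne_zero.2 ENNReal.ofReal_ne_top)] at h
  exact ENNReal.pow_ne_top hu.2.ne h

/-! ### Approximation by bounded frequencies -/

/-- The Fourier transform of `u`, restricted to a bounded set of frequencies. -/
def truncation (u : Lp ℂ 2 (volume : Measure SpaceTime)) (n : ℕ) (q : ℤ) : Plane → ℂ :=
  if q ∈ Finset.Icc (-n : ℤ) n then
    -- The factor `(2π)⁻¹` offsets the `2π` in the coefficients of `synthesis`.
    (Metric.closedBall 0 (n : ℝ)).indicator fun z => (2 * π : ℂ)⁻¹ * planeTransform u q z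
  else 0

theorem measurable_truncation (u : Lp ℂ 2 (volume : Measure SpaceTime)) (n : ℕ) (q : ℤ) :
    Measurable (truncation u n q) := by
  unfold truncation
  split_ifs
  · exact ((measurable_planeTransform u q).const_mul _).indicator Metric.isClosed_closedBall.measurableSet
  · exact measurable_const

theorem memLp_truncation (u : Lp ℂ 2 (volume : Measure SpaceTime)) (n : ℕ) (q : ℤ) :
    MemLp (truncation u n q) 2 := by
  unfold truncation
  split_ifs
  · exact ((Lp.memLp _).const_mul _).indicator Metric.isClosed_closedBall.measurableSet
  · exact MemLp.zero

theorem integrable_truncation (u : Lp ℂ 2 (volume : Measure SpaceTime)) (n : ℕ) (q : ℤ) :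
    Integrable (truncation u n q) := by
  unfold truncation
  split_ifs
  · rw [integrable_indicator_iff Metric.isClosed_closedBall.measurableSet]
    have : IsFiniteMeasure ((volume : Measure Plane).restrict (Metric.closedBall 0 (n : ℝ))) :=
      ⟨by rw [Measure.restrict_apply_univ]; exact measure_closedBall_lt_top⟩
    exact (((Lp.memLp (planeTransform u q)).const_mul _).restrict _).integrable (by norm_num)
  · exact integrable_zero _ _ _

theorem enorm_truncation_le (u : Lp ℂ 2 (volume : Measure SpaceTime)) (n : ℕ) (q : ℤ) (z : Plane) :
    ‖truncation u n q z‖ₑ ≤ ‖planeTransform u q z‖ₑ := by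
  unfold truncation
  split_ifs
  · refine (enorm_indicator_le_enorm_self _ _).trans ?_
    rw [enorm_mul]
    refine mul_le_of_le_one_left' ?_
    rw [← ofReal_norm, ENNReal.ofReal_le_one, norm_inv]
    apply inv_le_one_of_one_le₀
    simp only [norm_mul, Complex.norm_ofNat, Complex.norm_real, Real.norm_eq_abs,
      abs_of_pos Real.pi_pos]
    linarith [Real.pi_gt_three]
  · simp

/-- The part of `u` with frequencies in a bounded set. -/
def lowFrequency (u : Lp ℂ 2 (volume : Measure SpaceTime)) (n : ℕ) : SpaceTime → ℂ :=
  synthesis (Finset.Icc (-n : ℤ) n) (truncation u n)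

theorem continuous_lowFrequency (u : Lp ℂ 2 (volume : Measure SpaceTime)) (n : ℕ) :
    Continuous (lowFrequency u n) :=
  continuous_synthesis _ (integrable_truncation u n)

theorem yCoeff_sub_lowFrequency (u : Lp ℂ 2 (volume : Measure SpaceTime)) (n : ℕ) (q : ℤ) :
    yCoeff (fun p => u p - lowFrequency u n p) q =ᵐ[volume]
      (𝓕⁻ (planeTransform u q - ((memLp_truncation u n q).const_mul (2 * π : ℂ)).toLp _) :
        Lp ℂ 2 (volume : Measure Plane)) := by
  have hsub : 𝓕⁻ (planeTransform u q - ((memLp_truncation u n q).const_mul (2 * π : ℂ)).toLp _) =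
      𝓕⁻ (planeTransform u q) - 𝓕⁻ (((memLp_truncation u n q).const_mul (2 * π : ℂ)).toLp _) :=
    (Lp.fourierTransformₗᵢ Plane ℂ).symm.map_sub _ _
  rw [hsub]
  filter_upwards [ae_spaceTime_slice (Lp.memLp u), coeFn_fourierInv_planeTransform u q,
    coeFn_fourierInv_toLp ((integrable_truncation u n q).const_mul (2 * π : ℂ))
      ((memLp_truncation u n q).const_mul (2 * π : ℂ)),
    Lp.coeFn_sub (𝓕⁻ (planeTransform u q))
      (𝓕⁻ (((memLp_truncation u n q).const_mul (2 * π : ℂ)).toLp _))] with z h1 h2 h3 h4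
  rw [h4, Pi.sub_apply, h2, h3]
  have h5 : 𝓕⁻ (fun x => 2 * π * truncation u n q x) z = yCoeff (lowFrequency u n) q z := by
    rw [lowFrequency, yCoeff_synthesis _ _ (fun q hq => by simp only [truncation, if_neg hq])]
    simp only [Real.fourierInv_eq]
    rw [← integral_const_mul]
    congr 1; funext x
    simp only [Circle.smul_def, smul_eq_mul]
    ring
  rw [h5]
  unfold yCoeff
  rw [← integral_sub]
  · simp only [mul_sub]
  · exact ((h1.integrable (by norm_num)).bdd_mul (c := 1) (by fun_prop)
      (Filter.Eventually.of_forall fun y => by simp [fourier_apply, Circle.norm_coe]))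
  · refine Continuous.integrable_of_hasCompactSupport ?_ (HasCompactSupport.of_compactSpace _)
    exact (map_continuous _).mul ((continuous_lowFrequency u n).comp (by fun_prop))

/-- By Parseval and Plancherel the error is the `L²` mass of the transform outside a bounded set,
which vanishes in the limit by dominated convergence. -/
theorem tendsto_lowFrequency (u : Lp ℂ 2 (volume : Measure SpaceTime)) :
    Filter.Tendsto (fun n => eLpNorm (lowFrequency u n - (u : SpaceTime → ℂ)) 2 volume) Filter.atTop (nhds 0) := by
  classical
  set G : ℕ → Plane × ℤ → ℝ≥0∞ := fun n z =>
    ‖planeTransform u z.2 z.1 - 2 * π * truncation u n z.2 z.1‖ₑ ^ 2 with hG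
  have hGm : ∀ n, Measurable (G n) := fun n => Measurable.pow_const
    (measurable_from_prod_countable_left fun q => ((measurable_planeTransform u q).sub
      ((measurable_truncation u n q).const_mul _)).enorm) 2
  have hpi : (2 * π : ℂ) ≠ 0 := by exact_mod_cast Real.two_pi_pos.ne'
  have hGval : ∀ n z, G n z = if z.2 ∈ Finset.Icc (-n : ℤ) n ∧ z.1 ∈ Metric.closedBall 0 (n : ℝ)
      then 0 else ‖planeTransform u z.2 z.1‖ₑ ^ 2 := by
    intro n z
    simp only [hG, truncation]
    by_cases h1 : z.2 ∈ Finset.Icc (-n : ℤ) n <;>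
      by_cases h2 : z.1 ∈ Metric.closedBall 0 (n : ℝ) <;> simp only [h1, h2, if_true, if_false,
        Set.indicator_of_mem, Set.indicator_of_notMem, not_false_eq_true, true_and, false_and,
        mul_inv_cancel_left₀ hpi, sub_self, mul_zero, sub_zero, Pi.zero_apply]
    simp
  have hlim : Filter.Tendsto (fun n => ∫⁻ z, G n z ∂(volume.prod Measure.count)) Filter.atTop
      (nhds (∫⁻ z : Plane × ℤ, 0 ∂(volume.prod Measure.count))) := by
    refine tendsto_lintegral_of_dominated_convergence
      (fun z : Plane × ℤ => ‖planeTransform u z.2 z.1‖ₑ ^ 2) hGm (fun n => ?_) ?_ ?_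
    · refine Filter.Eventually.of_forall fun z => ?_
      dsimp only
      rw [hGval]
      split_ifs <;> simp
    · rw [lintegral_prod_symm, lintegral_count]
      · exact (tsum_lintegral_planeTransform_sq_lt_top u).ne
      · exact (Measurable.pow_const (measurable_from_prod_countable_left fun q =>
          (measurable_planeTransform u q).enorm) 2).aemeasurable
    · refine Filter.Eventually.of_forall fun z => ?_
      refine tendsto_const_nhds.congr' ?_
      filter_upwards [Filter.eventually_ge_atTop z.2.natAbs,
        Filter.eventually_ge_atTop ⌈‖z.1‖⌉₊] with n hn1 hn2
      rw [hGval, if_pos]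
      refine ⟨?_, ?_⟩
      · rw [Finset.mem_Icc]; omega
      · rw [mem_closedBall_zero_iff]; exact (Nat.le_ceil _).trans (by exact_mod_cast hn2)
  rw [lintegral_zero] at hlim
  have heq : ∀ n, eLpNorm (lowFrequency u n - (u : SpaceTime → ℂ)) 2 volume =
      ((ENNReal.ofReal (2 * π))⁻¹ * ∫⁻ z, G n z ∂(volume.prod Measure.count)) ^ (1 / 2 : ℝ) := by
    intro n
    have h1 : eLpNorm (lowFrequency u n - (u : SpaceTime → ℂ)) 2 volume ^ 2 =
        (ENNReal.ofReal (2 * π))⁻¹ * ∫⁻ z, G n z ∂(volume.prod Measure.count) := by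
      rw [eLpNorm_sub_comm, ← lintegral_enorm_sq, lintegral_prod_symm _ (hGm n).aemeasurable,
        lintegral_count]
      refine (lintegral_sq_spaceTime ((Lp.memLp u).1.sub
        (continuous_lowFrequency u n).aestronglyMeasurable) ?_ fun q => ?_).trans ?_
      · filter_upwards [ae_spaceTime_slice (Lp.memLp u)] with z hz
        refine hz.sub (Continuous.memLp_of_hasCompactSupport ?_
          (HasCompactSupport.of_compactSpace _))
        exact (continuous_lowFrequency u n).comp (by fun_prop)
      · exact (Lp.memLp _).1.congr (yCoeff_sub_lowFrequency u n q).symm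
      · congr 1
        refine tsum_congr fun q => ?_
        have e1 : ∫⁻ z, ‖yCoeff (fun p => u p - lowFrequency u n p) q z‖ₑ ^ 2 =
            ∫⁻ z, ‖(planeTransform u q -
              ((memLp_truncation u n q).const_mul (2 * π : ℂ)).toLp _ : Lp ℂ 2 volume) z‖ₑ ^ 2 := by
          rw [← lintegral_fourierInv_L2_sq]
          refine lintegral_congr_ae ?_
          filter_upwards [yCoeff_sub_lowFrequency u n q] with z hz
          rw [hz]
        refine e1.trans (lintegral_congr_ae ?_)
        filter_upwards [Lp.coeFn_sub (planeTransform u q)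
          (((memLp_truncation u n q).const_mul (2 * π : ℂ)).toLp _),
          ((memLp_truncation u n q).const_mul (2 * π : ℂ)).coeFn_toLp] with z hz1 hz2
        rw [hz1, Pi.sub_apply, hz2]
    rw [← h1, ← ENNReal.rpow_natCast, ← ENNReal.rpow_mul]
    norm_num
  simp only [heq]
  have h2 := ENNReal.Tendsto.const_mul hlim (a := (ENNReal.ofReal (2 * π))⁻¹)
    (Or.inr (ENNReal.inv_ne_top.2 (by simp [Real.pi_pos])))
  have h3 := h2.ennrpow_const (1 / 2 : ℝ)
  simpa using h3

end ZK

end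

/-! ### Passage to the limit -/

theorem theorem1p1 (ε b : ℝ) (hε : 0 < ε) (hb : 1 / 2 < b) :
    ∃ C : NNReal, ∀ u ∈ ZK.BourgainSpace ε b,
      eLpNorm u 4 (volume : Measure ZK.SpaceTime) ≤ C * ZK.bourgainNorm ε b u := by
  -- The kernel bound needs `b ≤ 1`; lowering `b` only decreases the norm on the right.
  obtain ⟨C₁, hC₁, h₁⟩ := ZK.exists_eLpNorm_synthesis_le (b := min b 1) hε
    (lt_min hb (by norm_num)) (min_le_right _ _)
  obtain ⟨C₂, hC₂, h₂⟩ := ZK.exists_weightedEnergy_le (b' := min b 1) hε.le (min_le_left b 1)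
  refine ⟨(C₁ * C₂).toNNReal, fun u _ => ?_⟩
  rw [ENNReal.coe_toNNReal (ENNReal.mul_lt_top hC₁ hC₂).ne]
  have hmeas : ∀ n, AEStronglyMeasurable (ZK.lowFrequency u n) volume := fun n =>
    (ZK.continuous_lowFrequency u n).aestronglyMeasurable
  -- Convergence in `L²` gives almost everywhere convergence along a subsequence, and Fatou carries
  -- the uniform `L⁴` bound to `u`.
  obtain ⟨ns, -, hns⟩ := (tendstoInMeasure_of_tendsto_eLpNorm two_ne_zero hmeas
    (Lp.memLp u).1 (ZK.tendsto_lowFrequency u)).exists_seq_tendsto_ae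
  refine (Lp.eLpNorm_lim_le_liminf_eLpNorm (fun n => hmeas (ns n)) _ hns).trans ?_
  refine Filter.liminf_le_of_le (by isBoundedDefault) fun a ha => ?_
  obtain ⟨n, hn⟩ := ha.exists
  refine hn.trans ((h₁ _ (ZK.truncation u (ns n)) (fun q hq => if_neg hq)
    (ZK.integrable_truncation u _) (ZK.measurable_truncation u _)).trans ?_)
  rw [mul_assoc]
  gcongr
  refine le_trans ?_ (h₂ u)
  gcongr
  exact ZK.weightedEnergy_mono fun q z => ZK.enorm_truncation_le u _ q z
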